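/- Let $d\ge 1$, let $\|\cdot\|_c$ be an arbitrary norm on $\mathbb R^d$, and let $\|\cdot\|$ be the Euclidean norm. Let $H:\mathbb R^d\to\mathbb R^d$ be a contraction with respect to $\|\cdot\|_c$, i.e. there is $\gamma\in[0,1)$ with $\|H(x)-H(y)\|_c\le\gamma\|x-y\|_c$ for all $x,y\in\mathbb R^d$. Let $p>1$, $\alpha>0$, $K>0$, $\xi\in\mathbb R$, put $\alpha_k=\alpha(k+K)^{-\xi}$ for $k\ge 0$, and let $\nu$ be a Borel probability measure on $\mathbb R^d$. Then $H$ has a unique fixed point $x^\star$, and the following are equivalent: 1. For every probability space and all random vectors $x_0$ (with law $\nu$) and $w_0,w_1,\dots$ in $\mathbb R^d$ on it, if the sequence defined by $$x_{k+1}=x_k+\alpha_k\bigl(H(x_k)-x_k+w_k\bigr),\qquad k\ge 0,$$ with $\mathcal F_k=\sigma(x_0,\dots,x_k)$, is such that every $w_k$ is integrable with $\mathbb E[w_k\mid\mathcal F_k]=0$ almost surely for all $k\ge 0$, and there are constants $A_p>0$, $B_p\ge 0$ with $$\mathbb E\bigl[\|w_k\|^p\mid\mathcal F_k\bigr]\le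 A_p+B_p\|x_k-x^\star\|^p\quad\text{almost surely, for all }k\ge 0,$$ then $x_k\to x^\star$ almost surely. 2. $\xi\in\left(\tfrac1p,1\right]$. -/

import Mathlib

open MeasureTheory Filter Topology

noncomputable section

/-- `ℝ^d` with its Euclidean norm. -/
abbrev Vec (d : ℕ) : Type := EuclideanSpace ℝ (Fin d)

/-- `c` is a norm on `ℝ^d`: a seminorm that vanishes only at the origin. -/
def IsNormOn {d : ℕ} (c : Seminorm ℝ (Vec d)) : Prop :=
  ∀ v : Vec d, c v = 0 → v = 0

/-- `H` is a contraction of `ℝ^d` with respect to the norm `c`. -/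
def IsContractionFor {d : ℕ} (c : Seminorm ℝ (Vec d)) (H : Vec d → Vec d) : Prop :=
  ∃ γ : ℝ, 0 ≤ γ ∧ γ < 1 ∧ ∀ u v : Vec d, c (H u - H v) ≤ γ * c (u - v)

/-- The step sizes `α (k + K)^(-ξ)`. -/
def stepSize (α K ξ : ℝ) (k : ℕ) : ℝ := α * ((k : ℝ) + K) ^ (-ξ)

/-- `F_k = σ(x_0, …, x_k)`, the σ-algebra generated by the first iterates. -/
abbrev historySigma {d : ℕ} {Ω : Type*} (x : ℕ → Ω → Vec d) (k : ℕ) : MeasurableSpace Ω :=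
  ⨆ j ≤ k, MeasurableSpace.comap (x j) inferInstance

/-- The recursion `x_{k+1} = x_k + a_k (H(x_k) - x_k + w_k)`. -/
def IsStochApprox {d : ℕ} {Ω : Type*} (H : Vec d → Vec d) (a : ℕ → ℝ)
    (x w : ℕ → Ω → Vec d) : Prop :=
  ∀ k ω, x (k + 1) ω = x k ω + a k • (H (x k ω) - x k ω + w k ω)

/-- Unbiased noise: each `w_k` is integrable and `E[w_k | F_k] = 0` almost surely. -/
def NoiseUnbiased {d : ℕ} {Ω : Type*} [MeasurableSpace Ω] (μ : Measure Ω)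
    (x w : ℕ → Ω → Vec d) : Prop :=
  ∀ k, Integrable (w k) μ ∧ μ[w k | historySigma x k] =ᵐ[μ] 0

/-- `p`-th moment growth: for some `A > 0` and `B ≥ 0`, for all `k`,
`E[‖w_k‖^p | F_k] ≤ A + B ‖x_k - x⋆‖^p` almost surely. The conditional expectation is that of a
nonnegative variable, with values in `[0, ∞]`, so that no integrability is presupposed. -/
def NoiseMomentGrowth {d : ℕ} {Ω : Type*} [MeasurableSpace Ω] (μ : Measure Ω) (p : ℝ)
    (xstar : Vec d) (x w : ℕ → Ω → Vec d) : Prop :=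
  ∃ A B : ℝ, 0 < A ∧ 0 ≤ B ∧ ∀ k,
    μ⁻[fun ω => ENNReal.ofReal (‖w k ω‖ ^ p) | historySigma x k] ≤ᵐ[μ]
      fun ω => ENNReal.ofReal (A + B * ‖x k ω - xstar‖ ^ p)

end

/-! The condition on `ξ` says exactly that `∑ α_k = ∞` and `∑ α_k ^ p < ∞`; the proof uses the step
sizes only through these two facts, their positivity and `α_k → 0`.

Sufficiency separates probability from dynamics, so the contraction norm never has to be smooth. The
noise may grow with the iterate; dividing it by a predictable nondecreasing scale `growthScale`,
comparable from below with `c (x_k - x⋆)`, leaves martingale differences with bounded conditional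
`p`-th moments. Their exponentially weighted averages `Y` tend to zero almost surely, coordinate by
coordinate (`ae_tendsto_average`). The Lyapunov function is `(|Y| - ε)₊ ^ p`: when `p > 2` the
expansion of a `p`-th power has a term of order `α_k ^ 2`, which need not be summable, but outside
the dead zone of width `ε` the drift of the averaging pays for it up to `O(α_k ^ p)`
(`exists_excess_shrink_le`). Adding the tail of `∑ α_k ^ p` gives a nonnegative supermartingale,
whose limit is zero because the means tend to zero.

The rest is deterministic. While the scale has a constant value `g`, the noise cancels in `(x_k -
x⋆) - g Y_k`, which performs contractive averaging with a vanishing error. Once `Y` is small the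
scale can jump at most once more (`growthScale_eventually_const`), so it freezes, and `∑ α_k = ∞`
forces convergence (`tendsto_zero_of_average_scaled_noise`).

Necessity is by counterexample. If `∑ α_k ^ p = ∞`, independent shocks of size `1 / α_k` with
probability about `α_k ^ p` have bounded `p`-th moment, and by Borel–Cantelli they throw the iterate
to distance at least one infinitely often. If `∑ α_k < ∞`, one shock moves the iterate off `x⋆`, and
the remaining total step is too small to bring it back. -/

/-! ### Norm equivalence and the fixed point. -/

theorem Seminorm.continuous_vec {d : ℕ} (c : Seminorm ℝ (Vec d)) : Continuous c :=
  continuousOn_univ.mp (ConvexOn.continuousOn isOpen_univ c.convexOn)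

/-- A norm on `ℝ^d` dominates a multiple of the Euclidean norm. -/
theorem IsNormOn.exists_norm_le {d : ℕ} {c : Seminorm ℝ (Vec d)} (hc : IsNormOn c) :
    ∃ M : ℝ, 0 < M ∧ ∀ v, ‖v‖ ≤ M * c v := by
  rcases (Metric.sphere (0 : Vec d) 1).eq_empty_or_nonempty with h | h
  · refine ⟨1, one_pos, fun v => ?_⟩
    have hv : v = 0 := by
      by_contra hv
      have : (‖v‖⁻¹ • v) ∈ Metric.sphere (0 : Vec d) 1 := by
        simp [norm_smul, norm_ne_zero_iff.mpr hv]
      rw [h] at this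
      exact this
    simp [hv]
  · obtain ⟨z, hz, hmin⟩ := (isCompact_sphere (0 : Vec d) 1).exists_isMinOn h
      c.continuous_vec.continuousOn
    have hz1 : ‖z‖ = 1 := by simpa using hz
    have hcz : 0 < c z := by
      refine lt_of_le_of_ne (apply_nonneg c z) fun h0 => ?_
      rw [hc z h0.symm] at hz1
      simp at hz1
    refine ⟨(c z)⁻¹, inv_pos.mpr hcz, fun v => ?_⟩
    by_cases hv : v = 0
    · simp [hv]
    have hv' : 0 < ‖v‖ := norm_pos_iff.mpr hv
    have h1 : c z ≤ c (‖v‖⁻¹ • v) := hmin (by simp [norm_smul, hv])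
    rw [map_smul_eq_mul, norm_inv, norm_norm] at h1
    rw [inv_mul_eq_div, le_div_iff₀ hcz]
    calc ‖v‖ * c z ≤ ‖v‖ * (‖v‖⁻¹ * c v) := by gcongr
      _ = c v := by field_simp

theorem Seminorm.exists_le_norm {d : ℕ} (c : Seminorm ℝ (Vec d)) :
    ∃ M : ℝ, 0 < M ∧ ∀ v, c v ≤ M * ‖v‖ :=
  Seminorm.bound_of_continuous_normedSpace c c.continuous_vec

theorem IsContractionFor.exists_iterate_bound {d : ℕ} {c : Seminorm ℝ (Vec d)} (hc : IsNormOn c)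
    {H : Vec d → Vec d} (hH : IsContractionFor c H) :
    ∃ M γ : ℝ, 0 ≤ M ∧ 0 ≤ γ ∧ γ < 1 ∧
      ∀ (n : ℕ) (u v : Vec d), ‖H^[n] u - H^[n] v‖ ≤ M * γ ^ n * ‖u - v‖ := by
  obtain ⟨γ, h0, h1, hγ⟩ := hH
  obtain ⟨M, hM, hM'⟩ := hc.exists_norm_le
  obtain ⟨N, hN, hN'⟩ := c.exists_le_norm
  have key : ∀ (n : ℕ) (u v : Vec d), c (H^[n] u - H^[n] v) ≤ γ ^ n * c (u - v) := by
    intro n u v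
    induction n with
    | zero => simp
    | succ n ih =>
      rw [Function.iterate_succ_apply', Function.iterate_succ_apply']
      calc _ ≤ γ * c (H^[n] u - H^[n] v) := hγ _ _
        _ ≤ γ * (γ ^ n * c (u - v)) := by gcongr
        _ = _ := by ring
  refine ⟨M * N, γ, by positivity, h0, h1, fun n u v => ?_⟩
  calc ‖H^[n] u - H^[n] v‖ ≤ M * c (H^[n] u - H^[n] v) := hM' _
    _ ≤ M * (γ ^ n * (N * ‖u - v‖)) := by
      gcongr
      exact (key n u v).trans (by gcongr; exact hN' _)
    _ = _ := by ring

theorem IsContractionFor.continuous {d : ℕ} {c : Seminorm ℝ (Vec d)} (hc : IsNormOn c)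
    {H : Vec d → Vec d} (hH : IsContractionFor c H) : Continuous H := by
  obtain ⟨M, γ, hM, hγ, -, h⟩ := hH.exists_iterate_bound hc
  refine (LipschitzWith.of_dist_le_mul (K := ⟨M * γ, by positivity⟩) fun u v => ?_).continuous
  rw [dist_eq_norm, dist_eq_norm]
  exact (show ‖H u - H v‖ ≤ M * γ * ‖u - v‖ by simpa using h 1 u v)

/-- The constant `M` may exceed one, so `H` need not contract the Euclidean distance, but a high
iterate does. The fixed point of that iterate is fixed by `H` as well. -/
theorem IsContractionFor.exists_fixedPoint {d : ℕ} {c : Seminorm ℝ (Vec d)} (hc : IsNormOn c)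
    {H : Vec d → Vec d} (hH : IsContractionFor c H) :
    ∃ xstar : Vec d, H xstar = xstar ∧ ∀ y : Vec d, H y = y → y = xstar := by
  obtain ⟨M, γ, hM, hγ, hγ1, h⟩ := hH.exists_iterate_bound hc
  have hlim : Tendsto (fun n : ℕ => M * γ ^ n) atTop (𝓝 0) := by
    simpa using (tendsto_pow_atTop_nhds_zero_of_lt_one hγ hγ1).const_mul M
  obtain ⟨n, hn⟩ := (hlim.eventually_lt_const one_pos).exists
  have hcon : ContractingWith ⟨M * γ ^ n, by positivity⟩ H^[n] :=
    ⟨by exact_mod_cast hn, LipschitzWith.of_dist_le_mul fun u v => by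
      rw [dist_eq_norm, dist_eq_norm]
      exact h n u v⟩
  refine ⟨_, hcon.isFixedPt_fixedPoint_iterate, fun y hy => ?_⟩
  exact hcon.fixedPoint_unique (Function.IsFixedPt.iterate (show Function.IsFixedPt H y from hy) n)

/-! ### Averaging recursions for real sequences. -/

/-- Iterated averaging with divergent total weight forgets the initial value. -/
theorem tendsto_zero_of_averaging {s r b : ℕ → ℝ} (hs : ∀ k, 0 ≤ s k)
    (hb : ∀ᶠ k in atTop, 0 ≤ b k ∧ b k ≤ 1) (hsum : ¬ Summable b)
    (hr : Tendsto r atTop (𝓝 0))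
    (hrec : ∀ᶠ k in atTop, s (k + 1) ≤ (1 - b k) * s k + b k * r k) :
    Tendsto s atTop (𝓝 0) := by
  rw [Metric.tendsto_atTop]
  intro ε hε
  have hε2 : 0 < ε / 2 := by positivity
  obtain ⟨N, hN⟩ := eventually_atTop.mp
    (hb.and (hrec.and (hr.eventually_le_const hε2)))
  -- Past `N` one has `r ≤ ε / 2`, so the offset `s - ε / 2` is multiplied by at most `1 - b ≤ exp
  -- (-b)` in each step.
  have hpos : ∀ n, s (N + n) - ε / 2 ≤
      Real.exp (-∑ i ∈ Finset.range n, b (N + i)) * s N := by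
    have hprod : ∀ n, s (N + n) - ε / 2 ≤ (∏ i ∈ Finset.range n, (1 - b (N + i))) * s N := by
      intro n
      induction n with
      | zero => simp; linarith
      | succ n ih =>
        obtain ⟨⟨h0, h1⟩, h2, h3⟩ := hN (N + n) (by omega)
        rw [Finset.prod_range_succ, ← add_assoc]
        have h4 : b (N + n) * r (N + n) ≤ b (N + n) * (ε / 2) := by gcongr
        have h5 := mul_le_mul_of_nonneg_left ih (sub_nonneg.mpr h1)
        linarith
    intro n
    refine (hprod n).trans ?_
    gcongr
    · exact hs N
    rw [← Finset.sum_neg_distrib, Real.exp_sum]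
    refine Finset.prod_le_prod (fun i _ => ?_) fun i _ => ?_
    · linarith [(hN (N + i) (by omega)).1.2]
    · linarith [Real.add_one_le_exp (-b (N + i))]
  have hdiv : Tendsto (fun n => ∑ i ∈ Finset.range n, b (N + i)) atTop atTop := by
    refine (not_summable_iff_tendsto_nat_atTop_of_nonneg
      fun i => (hN (N + i) (by omega)).1.1).mp fun h => hsum ?_
    refine (summable_nat_add_iff N).mp ?_
    simpa [add_comm] using h
  have hlim : Tendsto (fun n => Real.exp (-∑ i ∈ Finset.range n, b (N + i)) * s N) atTop
      (𝓝 0) := by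
    simpa using (Real.tendsto_exp_neg_atTop_nhds_zero.comp hdiv).mul_const (s N)
  obtain ⟨n₀, hn₀⟩ := eventually_atTop.mp (hlim.eventually_lt_const hε2)
  refine ⟨N + n₀, fun k hk => ?_⟩
  obtain ⟨n, rfl⟩ := Nat.exists_eq_add_of_le (show N ≤ k by omega)
  have h1 := hn₀ n (by omega)
  have h2 := hpos n
  rw [Real.dist_eq, sub_zero, abs_of_nonneg (hs _)]
  linarith

/-! ### The Lyapunov function with a dead zone: expansion and drift. -/

/-- The amount by which `|y|` exceeds `ε`. -/
noncomputable def excess (ε y : ℝ) : ℝ := max (|y| - ε) 0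

/-- The second-order weight in the expansion of `s ^ p`; it is needed only for `p > 2`. -/
noncomputable def curvWeight (p s : ℝ) : ℝ := if 2 < p then s ^ (p - 2) else 0

/-- The derivative of `excess ε y ^ p` in `y`. -/
noncomputable def excessSlope (p ε y : ℝ) : ℝ := p * excess ε y ^ (p - 1) * (if 0 ≤ y then 1 else -1)

theorem excess_nonneg (ε y : ℝ) : 0 ≤ excess ε y := le_max_right _ _

theorem excess_le_abs {ε : ℝ} (hε : 0 ≤ ε) (y : ℝ) : excess ε y ≤ |y| :=
  max_le (by linarith) (abs_nonneg y)

theorem curvWeight_nonneg {p s : ℝ} (hs : 0 ≤ s) : 0 ≤ curvWeight p s := by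
  unfold curvWeight
  split_ifs
  · positivity
  · exact le_rfl

/-- For `|t| ≥ 1 / 2` every term is dominated by `|t| ^ p`. For smaller `t` two uses of Bernoulli's
inequality bound the first-order remainder by a multiple of `t ^ 2`, and `t ^ 2 ≤ |t| ^ p` when `p ≤
2`; hence the quadratic term is needed only for `p > 2`. -/
theorem exists_abs_one_add_rpow_le {p : ℝ} (hp : 1 < p) :
    ∃ C : ℝ, 1 ≤ C ∧ ∀ t : ℝ,
      |1 + t| ^ p ≤ 1 + p * t + C * ((if 2 < p then t ^ 2 else 0) + |t| ^ p) := by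
  have h3p : (1 : ℝ) ≤ 3 ^ p := Real.one_le_rpow (by norm_num) (by linarith)
  have h2p : (0 : ℝ) < 2 ^ p := by positivity
  have h2q : (0 : ℝ) < 2 ^ (p - 1) := by positivity
  set K : ℝ := (p - 1) * (2 + 2 ^ (p - 1)) with hK
  have hK0 : 0 ≤ K := mul_nonneg (by linarith) (by linarith)
  have hpK : 0 ≤ p * K := mul_nonneg (by linarith) hK0
  have hp2 : 0 ≤ p * 2 ^ p := by positivity
  refine ⟨3 ^ p + p * 2 ^ p + p * K, by linarith, fun t => ?_⟩
  set W : ℝ := if 2 < p then t ^ 2 else 0 with hW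
  have hW0 : 0 ≤ W := by rw [hW]; split_ifs <;> positivity
  have ht0 : 0 ≤ |t| ^ p := by positivity
  rcases le_or_gt (1 / 2) |t| with ht | ht
  · have h1 : |1 + t| ^ p ≤ 3 ^ p * |t| ^ p := by
      rw [← Real.mul_rpow (by norm_num) (abs_nonneg t)]
      refine Real.rpow_le_rpow (abs_nonneg _) ?_ (by linarith)
      calc |1 + t| ≤ |1| + |t| := abs_add_le _ _
        _ ≤ 3 * |t| := by rw [abs_one]; linarith
    have h2 : |t| ≤ 2 ^ p * |t| ^ p := by
      rw [← Real.mul_rpow (by norm_num) (abs_nonneg t)]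
      calc |t| ≤ 2 * |t| := by linarith [abs_nonneg t]
        _ = (2 * |t|) ^ (1 : ℝ) := (Real.rpow_one _).symm
        _ ≤ (2 * |t|) ^ p := Real.rpow_le_rpow_of_exponent_le (by linarith) hp.le
    have h3 : -(p * t) ≤ p * (2 ^ p * |t| ^ p) := by
      calc -(p * t) = p * (-t) := by ring
        _ ≤ p * (2 ^ p * |t| ^ p) := by
          gcongr
          exact (neg_le_abs t).trans h2
    have h4 : 0 ≤ (3 ^ p + p * 2 ^ p + p * K) * W := by positivity
    have h5 : 0 ≤ p * K * |t| ^ p := by positivity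
    linarith
  · have ht' := abs_lt.mp ht
    have hx : 0 < 1 + t := by linarith
    rw [abs_of_pos hx]
    have hxp : (1 + t) ^ p = (1 + t) ^ (p - 1) * (1 + t) := by
      rw [← Real.rpow_add_one hx.ne']
      ring_nf
    set z := (1 + t) ^ (p - 1) with hz
    have hz0 : 0 < z := by positivity
    -- This is the tangent inequality at the other endpoint: Bernoulli for `(1 + t)⁻¹`, multiplied
    -- by `(1 + t) ^ p`.
    have hupper : (1 + t) ^ p ≤ 1 + p * t * z := by
      have hB : 1 + p * (-t / (1 + t)) ≤ (1 + -t / (1 + t)) ^ p :=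
        one_add_mul_self_le_rpow_one_add
          (by rw [le_div_iff₀ hx]; linarith) hp.le
      have hinv : 1 + -t / (1 + t) = (1 + t)⁻¹ := by field_simp; ring
      rw [hinv, Real.inv_rpow hx.le] at hB
      have hxp0 : 0 < (1 + t) ^ p := by positivity
      have := mul_le_mul_of_nonneg_right hB hxp0.le
      rw [inv_mul_cancel₀ hxp0.ne'] at this
      have he : (1 + p * (-t / (1 + t))) * (1 + t) ^ p = (1 + t) ^ p - p * t * z := by
        rw [hxp]; field_simp; ring
      linarith
    have hlower : 1 + p * t ≤ (1 + t) ^ p :=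
      one_add_mul_self_le_rpow_one_add (by linarith) hp.le
    have hmain : t * (z - 1) ≤ K * t ^ 2 := by
      rcases le_or_gt 0 t with h | h
      · have hz2 : z ≤ 2 ^ (p - 1) :=
          Real.rpow_le_rpow hx.le (by linarith) (by linarith)
        have h1 : z - 1 ≤ (p - 1) * t * z := by
          rw [hxp] at hupper
          linarith
        have h2 : (p - 1) * t * z ≤ (p - 1) * t * 2 ^ (p - 1) := by
          have : 0 ≤ (p - 1) * t := mul_nonneg (by linarith) h
          gcongr
        have h3 := mul_le_mul_of_nonneg_left (h1.trans h2) h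
        have h4 : 0 ≤ (p - 1) * t ^ 2 * 2 := by
          have : 0 ≤ p - 1 := by linarith
          positivity
        rw [hK]
        linarith
      · rw [hxp] at hlower
        have h1 : 2 * (p - 1) * t ≤ z - 1 := by
          by_contra hcon
          push Not at hcon
          have h2 : (z - 1) * (1 + t) < 2 * (p - 1) * t * (1 + t) :=
            mul_lt_mul_of_pos_right hcon hx
          have h3 : 0 ≤ (p - 1) * (-t) * (1 + 2 * t) :=
            mul_nonneg (mul_nonneg (by linarith) (by linarith)) (by linarith)
          linarith
        have h2 := mul_le_mul_of_nonpos_left h1 h.le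
        have h4 : 0 ≤ (p - 1) * t ^ 2 * 2 ^ (p - 1) := by
          have : 0 ≤ p - 1 := by linarith
          positivity
        rw [hK]
        linarith
    have hsq : t ^ 2 ≤ W + |t| ^ p := by
      rw [hW]
      split_ifs with h2
      · linarith
      · rw [zero_add, ← sq_abs, ← Real.rpow_natCast]
        refine Real.rpow_le_rpow_of_exponent_ge' (abs_nonneg t) (by linarith) (by linarith) ?_
        push_cast
        linarith
    have h6 : p * (t * (z - 1)) ≤ p * (K * (W + |t| ^ p)) := by
      have : t * (z - 1) ≤ K * (W + |t| ^ p) := hmain.trans (by gcongr)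
      gcongr
    have h7 : 0 ≤ (3 ^ p + p * 2 ^ p) * (W + |t| ^ p) := by positivity
    linarith

/-- By homogeneity this is the case `s = 1` with `t = h / s`; at `s = 0` only `|h| ^ p` is left. -/
theorem exists_abs_add_rpow_le {p : ℝ} (hp : 1 < p) :
    ∃ C : ℝ, 1 ≤ C ∧ ∀ s h : ℝ, 0 ≤ s →
      |s + h| ^ p ≤ s ^ p + p * s ^ (p - 1) * h + C * (curvWeight p s * h ^ 2 + |h| ^ p) := by
  obtain ⟨C, hC, hmain⟩ := exists_abs_one_add_rpow_le hp
  refine ⟨C, hC, fun s h hs => ?_⟩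
  rcases hs.eq_or_lt with rfl | hs
  · have h1 : 0 ≤ curvWeight p 0 * h ^ 2 := mul_nonneg (curvWeight_nonneg le_rfl) (sq_nonneg h)
    have h2 : 0 ≤ |h| ^ p := by positivity
    rw [zero_add, Real.zero_rpow (by linarith), Real.zero_rpow (by linarith)]
    nlinarith
  · have h1 := mul_le_mul_of_nonneg_left (hmain (h / s)) (Real.rpow_nonneg hs.le p)
    have e1 : s ^ p * |1 + h / s| ^ p = |s + h| ^ p := by
      rw [← Real.mul_rpow hs.le (abs_nonneg _)]
      congr 1
      rw [← abs_of_pos hs, ← abs_mul, abs_of_pos hs]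
      congr 1
      field_simp
    have e2 : s ^ p * |h / s| ^ p = |h| ^ p := by
      rw [← Real.mul_rpow hs.le (abs_nonneg _), abs_div, abs_of_pos hs]
      congr 1
      field_simp
    have e3 : s ^ p * (if 2 < p then (h / s) ^ 2 else 0) = curvWeight p s * h ^ 2 := by
      unfold curvWeight
      split_ifs
      · rw [Real.rpow_sub hs, Real.rpow_two]
        field_simp
      · simp
    have e4 : s ^ p * (p * (h / s)) = p * s ^ (p - 1) * h := by
      rw [Real.rpow_sub_one hs.ne']
      field_simp
    calc |s + h| ^ p = s ^ p * |1 + h / s| ^ p := e1.symm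
      _ ≤ _ := h1
      _ = s ^ p + s ^ p * (p * (h / s)) +
          C * (s ^ p * (if 2 < p then (h / s) ^ 2 else 0) + s ^ p * |h / s| ^ p) := by ring
      _ = _ := by rw [e2, e3, e4]

theorem excess_add_le {ε : ℝ} (hε : 0 ≤ ε) (y h : ℝ) :
    excess ε (y + h) ≤ |excess ε y + (if 0 ≤ y then 1 else -1) * h| := by
  refine max_le ?_ (abs_nonneg _)
  unfold excess
  rcases le_total (|y| - ε) 0 with h0 | h0
  · rw [max_eq_right h0]
    have := abs_add_le y h
    split_ifs
    · rw [zero_add, one_mul]; linarith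
    · rw [zero_add, neg_one_mul, abs_neg]; linarith
  · rw [max_eq_left h0]
    split_ifs with hy
    · rw [abs_of_nonneg hy, one_mul]
      rw [abs_of_nonneg hy] at h0
      have h1 := le_abs_self (y - ε + h)
      have h2 := neg_le_abs (y - ε + h)
      rcases abs_cases (y + h) with ⟨h3, -⟩ | ⟨h3, -⟩ <;> linarith
    · push Not at hy
      rw [abs_of_neg hy] at h0 ⊢
      have h1 := le_abs_self (-y - ε + -1 * h)
      have h2 := neg_le_abs (-y - ε + -1 * h)
      rcases abs_cases (y + h) with ⟨h3, -⟩ | ⟨h3, -⟩ <;> linarith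

theorem exists_excess_add_rpow_le {p : ℝ} (hp : 1 < p) :
    ∃ C : ℝ, 1 ≤ C ∧ ∀ ε y h : ℝ, 0 ≤ ε →
      excess ε (y + h) ^ p ≤ excess ε y ^ p + excessSlope p ε y * h +
        C * (curvWeight p (excess ε y) * h ^ 2 + |h| ^ p) := by
  obtain ⟨C, hC, hmain⟩ := exists_abs_add_rpow_le hp
  refine ⟨C, hC, fun ε y h hε => ?_⟩
  set σ : ℝ := if 0 ≤ y then 1 else -1 with hσ
  have hσ1 : |σ| = 1 := by rw [hσ]; split_ifs <;> simp
  have hσ2 : σ ^ 2 = 1 := by rw [← sq_abs, hσ1, one_pow]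
  have h1 := hmain (excess ε y) (σ * h) (excess_nonneg ε y)
  rw [abs_mul, hσ1, one_mul, mul_pow, hσ2, one_mul] at h1
  calc excess ε (y + h) ^ p ≤ |excess ε y + σ * h| ^ p :=
        Real.rpow_le_rpow (excess_nonneg _ _) (excess_add_le hε y h) (by linarith)
    _ ≤ _ := h1
    _ = _ := by rw [excessSlope, ← hσ]; ring

/-- This is what the dead zone is for. If the excess `g'` after shrinking is positive, the excess
before satisfies `(1 - a) * g ≥ g' + a * ε`, and convexity yields a gain `p * g' ^ (p - 1) * a * ε`.
It beats the curvature term `C * a ^ 2 * g' ^ (p - 2)` when `g' ≥ C * a / ε`; otherwise that term is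
at most `C * (C / ε) ^ (p - 2) * a ^ p`. -/
theorem exists_excess_shrink_le {p : ℝ} (hp : 1 < p) {ε C : ℝ} (hε : 0 < ε) (hC : 0 ≤ C) :
    ∃ C' : ℝ, 0 ≤ C' ∧ ∀ a y : ℝ, 0 ≤ a → a ≤ 1 →
      excess ε ((1 - a) * y) ^ p + C * a ^ 2 * curvWeight p (excess ε ((1 - a) * y)) ≤
        (1 - a) * excess ε y ^ p + C' * a ^ p := by
  refine ⟨C * (C / ε) ^ (p - 2), by positivity, fun a y ha ha1 => ?_⟩
  have hb : 0 ≤ 1 - a := by linarith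
  set g := excess ε y with hg
  set g' := excess ε ((1 - a) * y) with hg'
  have hg0 : 0 ≤ g := excess_nonneg _ _
  have hg'0 : 0 ≤ g' := excess_nonneg _ _
  have hgy : |y| - ε ≤ g := le_max_left _ _
  have hscale : ((1 - a) * g) ^ p ≤ (1 - a) * g ^ p := by
    rw [Real.mul_rpow hb hg0]
    gcongr
    calc (1 - a) ^ p ≤ (1 - a) ^ (1 : ℝ) :=
          Real.rpow_le_rpow_of_exponent_ge' hb (by linarith) (by norm_num) hp.le
      _ = 1 - a := Real.rpow_one _
  have hC' : 0 ≤ C * (C / ε) ^ (p - 2) * a ^ p := by positivity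
  rcases hg'0.eq_or_lt with h0 | h0
  · have hcurv : curvWeight p g' = 0 := by
      rw [← h0, curvWeight]
      split_ifs with h2
      · exact Real.zero_rpow (by linarith)
      · rfl
    rw [hcurv, ← h0, Real.zero_rpow (by linarith)]
    have : 0 ≤ (1 - a) * g ^ p := by positivity
    linarith
  have hstep : g' + a * ε ≤ (1 - a) * g := by
    have h1 : g' = (1 - a) * |y| - ε := by
      rw [hg', excess, abs_mul, abs_of_nonneg hb] at h0 ⊢
      refine max_eq_left ?_
      rcases lt_max_iff.mp h0 with h | h
      · exact h.le
      · exact absurd h (lt_irrefl _)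
    have := mul_le_mul_of_nonneg_left hgy hb
    linarith
  have hBern : g' ^ p + p * g' ^ (p - 1) * (a * ε) ≤ (g' + a * ε) ^ p := by
    have h1 : 1 + p * (a * ε / g') ≤ (1 + a * ε / g') ^ p :=
      one_add_mul_self_le_rpow_one_add
        (le_trans (by norm_num) (show 0 ≤ a * ε / g' by positivity)) hp.le
    have h2 := mul_le_mul_of_nonneg_left h1 (Real.rpow_nonneg hg'0 p)
    rw [← Real.mul_rpow hg'0 (by positivity)] at h2
    have e1 : g' * (1 + a * ε / g') = g' + a * ε := by field_simp
    have e2 : g' ^ p * (1 + p * (a * ε / g')) = g' ^ p + p * g' ^ (p - 1) * (a * ε) := by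
      rw [Real.rpow_sub_one h0.ne']
      field_simp
    rwa [e1, e2] at h2
  have hpow : (g' + a * ε) ^ p ≤ ((1 - a) * g) ^ p :=
    Real.rpow_le_rpow (by positivity) hstep (by linarith)
  have hlin : 0 ≤ p * g' ^ (p - 1) * (a * ε) := by positivity
  unfold curvWeight
  split_ifs with h2
  · rcases le_or_gt (C * a / ε) g' with h | h
    · have h3 : C * a ≤ g' * ε := by rwa [div_le_iff₀ hε] at h
      have e : g' ^ (p - 1) = g' ^ (p - 2) * g' := by
        rw [← Real.rpow_add_one h0.ne']; ring_nf
      have h4 : C * a ^ 2 * g' ^ (p - 2) ≤ p * g' ^ (p - 1) * (a * ε) := by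
        rw [e]
        have h5 : (a * g' ^ (p - 2)) * (C * a) ≤ (a * g' ^ (p - 2)) * (g' * ε) := by gcongr
        have h6 : 0 ≤ (p - 1) * ((a * g' ^ (p - 2)) * (g' * ε)) :=
          mul_nonneg (by linarith) (by positivity)
        linarith
      linarith
    · have ha0 : 0 < a := by
        rcases ha.eq_or_lt with rfl | h'
        · rw [mul_zero, zero_div] at h; linarith
        · exact h'
      have h3 : g' ^ (p - 2) ≤ (C / ε) ^ (p - 2) * a ^ (p - 2) := by
        rw [← Real.mul_rpow (by positivity) ha]
        refine Real.rpow_le_rpow hg'0 ?_ (by linarith)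
        rw [div_mul_eq_mul_div]
        exact h.le
      have e : a ^ p = a ^ (p - 2) * a ^ 2 := by
        rw [← Real.rpow_two, ← Real.rpow_add ha0]; ring_nf
      have h4 : C * a ^ 2 * g' ^ (p - 2) ≤ C * (C / ε) ^ (p - 2) * a ^ p := by
        calc C * a ^ 2 * g' ^ (p - 2) ≤ C * a ^ 2 * ((C / ε) ^ (p - 2) * a ^ (p - 2)) := by
              gcongr
          _ = _ := by rw [e]; ring
      linarith
  · linarith

theorem rpow_mul_rpow_le_add {u v r s : ℝ} (hu : 0 ≤ u) (hv : 0 ≤ v) (hr : 0 ≤ r) (hs : 0 ≤ s) :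
    u ^ r * v ^ s ≤ u ^ (r + s) + v ^ (r + s) := by
  have h1 : 0 ≤ u ^ (r + s) := by positivity
  have h2 : 0 ≤ v ^ (r + s) := by positivity
  rcases le_total u v with h | h
  · calc u ^ r * v ^ s ≤ v ^ r * v ^ s := by gcongr
      _ = v ^ (r + s) := (Real.rpow_add_of_nonneg hv hr hs).symm
      _ ≤ _ := by linarith
  · calc u ^ r * v ^ s ≤ u ^ r * u ^ s := by gcongr
      _ = u ^ (r + s) := (Real.rpow_add_of_nonneg hu hr hs).symm
      _ ≤ _ := by linarith

theorem abs_add_rpow_le_two_rpow {p : ℝ} (hp : 0 ≤ p) (u v : ℝ) :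
    |u + v| ^ p ≤ 2 ^ p * (|u| ^ p + |v| ^ p) := by
  have key : ∀ x y : ℝ, |x| ≤ |y| → |x + y| ^ p ≤ 2 ^ p * |y| ^ p := fun x y h => by
    rw [← Real.mul_rpow (by norm_num) (abs_nonneg _)]
    exact Real.rpow_le_rpow (abs_nonneg _) ((abs_add_le x y).trans (by linarith)) hp
  have h2 : (0 : ℝ) ≤ 2 ^ p := by positivity
  have hu : 0 ≤ |u| ^ p := by positivity
  have hv : 0 ≤ |v| ^ p := by positivity
  rcases le_total |u| |v| with h | h
  · nlinarith [key u v h]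
  · have := key v u h
    rw [add_comm] at this
    nlinarith

theorem continuous_excess (ε : ℝ) : Continuous (excess ε) := by
  unfold excess
  fun_prop

theorem measurable_excessSlope (p ε : ℝ) : Measurable (excessSlope p ε) := by
  unfold excessSlope
  have := (continuous_excess ε).measurable
  refine (measurable_const.mul (this.pow_const _)).mul ?_
  exact Measurable.ite measurableSet_Ici measurable_const measurable_const

theorem measurable_curvWeight (p : ℝ) : Measurable (curvWeight p) := by
  unfold curvWeight
  split_ifs <;> fun_prop

/-! ### Conditional expectation of the Lyapunov function after one step. -/

section OneStep

variable {Ω : Type*} {m m0 : MeasurableSpace Ω} {μ : Measure Ω}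

theorem integrable_abs_add_rpow {p : ℝ} (hp : 0 ≤ p) {u v : Ω → ℝ}
    (hum : AEStronglyMeasurable u μ) (hvm : AEStronglyMeasurable v μ)
    (hu : Integrable (fun ω => |u ω| ^ p) μ) (hv : Integrable (fun ω => |v ω| ^ p) μ) :
    Integrable (fun ω => |u ω + v ω| ^ p) μ := by
  refine ((hu.add hv).const_mul (2 ^ p)).mono' ?_ (ae_of_all _ fun ω => ?_)
  · exact ((hum.add hvm).aemeasurable.abs.pow_const p).aestronglyMeasurable
  · rw [Real.norm_of_nonneg (by positivity)]
    exact abs_add_rpow_le_two_rpow hp _ _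

theorem integrable_const_mul_abs_rpow {p : ℝ} {v : Ω → ℝ} (a : ℝ)
    (hv : Integrable (fun ω => |v ω| ^ p) μ) : Integrable (fun ω => |a * v ω| ^ p) μ := by
  simp_rw [abs_mul, Real.mul_rpow (abs_nonneg a) (abs_nonneg _)]
  exact hv.const_mul _

theorem integrable_excess_rpow {p ε : ℝ} (hp : 0 ≤ p) (hε : 0 ≤ ε) {u : Ω → ℝ}
    (hum : AEStronglyMeasurable u μ) (hu : Integrable (fun ω => |u ω| ^ p) μ) :
    Integrable (fun ω => excess ε (u ω) ^ p) μ := by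
  refine hu.mono' ?_ (ae_of_all _ fun ω => ?_)
  · exact (((continuous_excess ε).measurable.comp_aemeasurable
      hum.aemeasurable).pow_const p).aestronglyMeasurable
  · rw [Real.norm_of_nonneg (Real.rpow_nonneg (excess_nonneg _ _) _)]
    exact Real.rpow_le_rpow (excess_nonneg _ _) (excess_le_abs hε _) hp

/-- One noisy step changes the conditional mean of `excess ε y ^ p` only to second order. -/
theorem condExp_excess_add_le [IsProbabilityMeasure μ] {p C ε a M : ℝ} (hp : 1 < p) (hC0 : 0 ≤ C)
    (hC : ∀ ε y h : ℝ, 0 ≤ ε →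
      excess ε (y + h) ^ p ≤ excess ε y ^ p + excessSlope p ε y * h +
        C * (curvWeight p (excess ε y) * h ^ 2 + |h| ^ p))
    (hm : m ≤ m0) (hε : 0 ≤ ε) (ha : 0 ≤ a) {y w : Ω → ℝ}
    (hy : StronglyMeasurable[m] y) (hyp : Integrable (fun ω => |y ω| ^ p) μ)
    (hw : Integrable w μ) (hw0 : μ[w | m] =ᵐ[μ] 0)
    (hwp : Integrable (fun ω => |w ω| ^ p) μ)
    (hM : μ[fun ω => |w ω| ^ p | m] ≤ᵐ[μ] fun _ => M) :
    μ[fun ω => excess ε (y ω + a * w ω) ^ p | m] ≤ᵐ[μ]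
      fun ω => excess ε (y ω) ^ p + C * (1 + M) * a ^ 2 * curvWeight p (excess ε (y ω)) +
        C * M * a ^ p := by
  have hp0 : 0 ≤ p := by linarith
  have hym : AEStronglyMeasurable y μ := (hy.mono hm).aestronglyMeasurable
  have hD : StronglyMeasurable[m] fun ω => excessSlope p ε (y ω) :=
    ((measurable_excessSlope p ε).comp hy.measurable).stronglyMeasurable
  have hexc : Measurable[m] fun ω => excess ε (y ω) :=
    (continuous_excess ε).measurable.comp hy.measurable
  have hR : StronglyMeasurable[m] fun ω => curvWeight p (excess ε (y ω)) :=
    ((measurable_curvWeight p).comp hexc).stronglyMeasurable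
  have hΦ : StronglyMeasurable[m] fun ω => excess ε (y ω) ^ p :=
    (hexc.pow_const p).stronglyMeasurable
  have I0 : Integrable (fun ω => excess ε (y ω + a * w ω) ^ p) μ :=
    integrable_excess_rpow hp0 hε (hym.add (hw.aestronglyMeasurable.const_mul a))
      (integrable_abs_add_rpow hp0 hym (hw.aestronglyMeasurable.const_mul a) hyp
        (integrable_const_mul_abs_rpow a hwp))
  have I1 : Integrable (fun ω => excess ε (y ω) ^ p) μ := integrable_excess_rpow hp0 hε hym hyp
  have I2 : Integrable ((fun ω => excessSlope p ε (y ω)) * w) μ := by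
    refine ((hyp.add hwp).const_mul p).mono'
      ((hD.mono hm).aestronglyMeasurable.mul hw.aestronglyMeasurable) (ae_of_all _ fun ω => ?_)
    have hg := excess_nonneg ε (y ω)
    have h1 : ‖excessSlope p ε (y ω)‖ = p * excess ε (y ω) ^ (p - 1) := by
      unfold excessSlope
      rw [norm_mul, Real.norm_of_nonneg (by positivity)]
      split_ifs <;> simp
    rw [Pi.mul_apply, norm_mul, h1, mul_assoc]
    refine mul_le_mul_of_nonneg_left ?_ hp0
    calc excess ε (y ω) ^ (p - 1) * ‖w ω‖ ≤ |y ω| ^ (p - 1) * |w ω| ^ (1 : ℝ) := by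
          rw [Real.rpow_one, Real.norm_eq_abs]
          gcongr
          exact excess_le_abs hε _
      _ ≤ |y ω| ^ (p - 1 + 1) + |w ω| ^ (p - 1 + 1) :=
          rpow_mul_rpow_le_add (abs_nonneg _) (abs_nonneg _) (by linarith) zero_le_one
      _ = |y ω| ^ p + |w ω| ^ p := by rw [sub_add_cancel]
  have hquad : Integrable ((fun ω => curvWeight p (excess ε (y ω))) * fun ω => w ω ^ 2) μ ∧
      μ[(fun ω => curvWeight p (excess ε (y ω))) * (fun ω => w ω ^ 2) | m] ≤ᵐ[μ]
        fun ω => (1 + M) * curvWeight p (excess ε (y ω)) := by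
    -- For `p > 2` the conditional second moment is at most `1 + M`, since `w ^ 2 ≤ 1 + |w| ^ p`;
    -- for `p ≤ 2` the weight vanishes, so no second moment is needed.
    by_cases h2 : 2 < p
    · have hR' : ∀ ω, curvWeight p (excess ε (y ω)) = excess ε (y ω) ^ (p - 2) := fun ω => by
        simp [curvWeight, h2]
      have hwm2 : AEStronglyMeasurable (fun ω => w ω ^ 2) μ := hw.aestronglyMeasurable.pow 2
      have hsq : ∀ ω, w ω ^ 2 ≤ 1 + |w ω| ^ p := fun ω => by
        have h := rpow_mul_rpow_le_add zero_le_one (abs_nonneg (w ω))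
          (show (0 : ℝ) ≤ p - 2 by linarith) (zero_le_two)
        rwa [Real.one_rpow, Real.one_rpow, one_mul, sub_add_cancel, Real.rpow_two, sq_abs] at h
      have hw2 : Integrable (fun ω => w ω ^ 2) μ := by
        refine ((integrable_const (1 : ℝ)).add hwp).mono' hwm2 (ae_of_all _ fun ω => ?_)
        rw [Real.norm_of_nonneg (sq_nonneg _)]
        exact hsq ω
      have hI : Integrable ((fun ω => curvWeight p (excess ε (y ω))) * fun ω => w ω ^ 2) μ := by
        refine (hyp.add hwp).mono' ((hR.mono hm).aestronglyMeasurable.mul hwm2)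
          (ae_of_all _ fun ω => ?_)
        have hg := excess_nonneg ε (y ω)
        rw [Pi.mul_apply, hR', Real.norm_of_nonneg (by positivity)]
        calc excess ε (y ω) ^ (p - 2) * w ω ^ 2 ≤ |y ω| ^ (p - 2) * |w ω| ^ (2 : ℝ) := by
              rw [Real.rpow_two, sq_abs]
              gcongr
              exact excess_le_abs hε _
          _ ≤ |y ω| ^ (p - 2 + 2) + |w ω| ^ (p - 2 + 2) :=
              rpow_mul_rpow_le_add (abs_nonneg _) (abs_nonneg _) (by linarith) zero_le_two
          _ = |y ω| ^ p + |w ω| ^ p := by rw [sub_add_cancel]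
      refine ⟨hI, ?_⟩
      have h1 : μ[fun ω => w ω ^ 2 | m] ≤ᵐ[μ] μ[(fun _ => (1 : ℝ)) + fun ω => |w ω| ^ p | m] :=
        condExp_mono hw2 ((integrable_const (1 : ℝ)).add hwp) (ae_of_all _ hsq)
      filter_upwards [condExp_mul_of_stronglyMeasurable_left hR hI hw2, h1, hM,
        condExp_add (integrable_const (1 : ℝ)) hwp m] with ω e1 e2 e3 e4
      rw [e4, Pi.add_apply, condExp_const hm] at e2
      rw [e1, Pi.mul_apply, mul_comm]
      have := curvWeight_nonneg (p := p) (excess_nonneg ε (y ω))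
      gcongr
      linarith
    · have hR' : (fun ω => curvWeight p (excess ε (y ω))) = 0 := by
        ext ω; simp [curvWeight, h2]
      rw [hR', zero_mul]
      refine ⟨integrable_zero _ _ _, ?_⟩
      rw [condExp_zero]
      refine ae_of_all _ fun ω => ?_
      simp [curvWeight, h2]
  obtain ⟨I3, hq⟩ := hquad
  have hexpand : (fun ω => excess ε (y ω + a * w ω) ^ p) ≤ᵐ[μ]
      (fun ω => excess ε (y ω) ^ p) + (a • ((fun ω => excessSlope p ε (y ω)) * w) +
        ((C * a ^ 2) • ((fun ω => curvWeight p (excess ε (y ω))) * fun ω => w ω ^ 2) +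
          (C * a ^ p) • fun ω => |w ω| ^ p)) := by
    refine ae_of_all _ fun ω => (hC ε (y ω) (a * w ω) hε).trans_eq ?_
    simp only [Pi.add_apply, Pi.smul_apply, Pi.mul_apply, smul_eq_mul, abs_mul, abs_of_nonneg ha,
      Real.mul_rpow ha (abs_nonneg _)]
    ring
  have J3 := I3.smul (C * a ^ 2)
  have J4 := hwp.smul (C * a ^ p)
  have J2 := I2.smul a
  have hmono := condExp_mono (m := m) I0 (I1.add (J2.add (J3.add J4))) hexpand
  filter_upwards [hmono, condExp_add I1 (J2.add (J3.add J4)) m, condExp_add J2 (J3.add J4) m,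
    condExp_add J3 J4 m, condExp_smul a ((fun ω => excessSlope p ε (y ω)) * w) m (μ := μ),
    condExp_smul (C * a ^ 2)
      ((fun ω => curvWeight p (excess ε (y ω))) * fun ω => w ω ^ 2) m (μ := μ),
    condExp_smul (C * a ^ p) (fun ω => |w ω| ^ p) m (μ := μ),
    condExp_mul_of_stronglyMeasurable_left hD I2 hw, hw0, hq, hM]
    with ω e0 e1 e2 e3 e4 e5 e6 e7 e8 e9 e10
  rw [e1, Pi.add_apply, e2, Pi.add_apply, e3, Pi.add_apply, e4, e5, e6,
    condExp_of_stronglyMeasurable hm hΦ I1] at e0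
  simp only [Pi.smul_apply, smul_eq_mul] at e0
  rw [e7, Pi.mul_apply, e8, Pi.zero_apply, mul_zero, mul_zero, zero_add] at e0
  have h1 := mul_le_mul_of_nonneg_left e9 (show 0 ≤ C * a ^ 2 by positivity)
  have h2 := mul_le_mul_of_nonneg_left e10 (show 0 ≤ C * a ^ p by positivity)
  linarith

end OneStep

/-! ### Almost sure convergence of averaged martingale differences. -/

section Averages

variable {Ω : Type*} {m0 : MeasurableSpace Ω} {μ : Measure Ω} [IsProbabilityMeasure μ]
  {ℱ : Filtration ℕ m0} {Y w : ℕ → Ω → ℝ} {a : ℕ → ℝ} {p M : ℝ}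

theorem stronglyAdapted_average (hY0 : Y 0 = 0)
    (hrec : ∀ k ω, Y (k + 1) ω = (1 - a k) * Y k ω + a k * w k ω)
    (hw : ∀ k, StronglyMeasurable[ℱ (k + 1)] (w k)) : StronglyAdapted ℱ Y := by
  intro k
  induction k with
  | zero => rw [hY0]; exact stronglyMeasurable_zero
  | succ k ih =>
    have h : Y (k + 1) = fun ω => (1 - a k) * Y k ω + a k * w k ω := funext (hrec k)
    rw [h]
    exact ((ih.mono (ℱ.mono k.le_succ)).const_mul _).add ((hw k).const_mul _)

theorem integrable_average_rpow (hp : 1 < p) (hY0 : Y 0 = 0)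
    (hrec : ∀ k ω, Y (k + 1) ω = (1 - a k) * Y k ω + a k * w k ω)
    (hw : ∀ k, StronglyMeasurable[ℱ (k + 1)] (w k))
    (hwp : ∀ k, Integrable (fun ω => |w k ω| ^ p) μ) (k : ℕ) :
    Integrable (fun ω => |Y k ω| ^ p) μ := by
  have hp0 : 0 ≤ p := by linarith
  have hY := stronglyAdapted_average hY0 hrec hw
  induction k with
  | zero =>
    rw [hY0]
    simp [Real.zero_rpow (by linarith : p ≠ 0)]
  | succ k ih =>
    simp_rw [hrec k]
    exact integrable_abs_add_rpow hp0
      (((hY k).mono (ℱ.le k)).aestronglyMeasurable.const_mul _)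
      (((hw k).mono (ℱ.le _)).aestronglyMeasurable.const_mul _)
      (integrable_const_mul_abs_rpow _ ih) (integrable_const_mul_abs_rpow _ (hwp k))

/-- Averages of martingale differences with bounded conditional `p`-th moments, with step sizes
that are `p`-summable but not summable: they eventually exceed `ε` by arbitrarily little. -/
theorem ae_tendsto_excess_average (hp : 1 < p) (hY0 : Y 0 = 0)
    (hrec : ∀ k ω, Y (k + 1) ω = (1 - a k) * Y k ω + a k * w k ω)
    (hw : ∀ k, StronglyMeasurable[ℱ (k + 1)] (w k))
    (hwi : ∀ k, Integrable (w k) μ) (hw0 : ∀ k, μ[w k | ℱ k] =ᵐ[μ] 0)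
    (hwp : ∀ k, Integrable (fun ω => |w k ω| ^ p) μ) (hM0 : 0 ≤ M)
    (hM : ∀ k, μ[fun ω => |w k ω| ^ p | ℱ k] ≤ᵐ[μ] fun _ => M)
    (ha : ∀ k, 0 ≤ a k ∧ a k ≤ 1) (hsum : ¬ Summable a) (hsump : Summable fun k => a k ^ p)
    {ε : ℝ} (hε : 0 < ε) :
    ∀ᵐ ω ∂μ, Tendsto (fun k => excess ε (Y k ω) ^ p) atTop (𝓝 0) := by
  have hp0 : 0 ≤ p := by linarith
  have hY := stronglyAdapted_average hY0 hrec hw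
  have hYp := integrable_average_rpow hp hY0 hrec hw hwp
  obtain ⟨C, hC1, hC⟩ := exists_excess_add_rpow_le hp
  have hC0 : 0 ≤ C := by linarith
  obtain ⟨C', hC'0, hC'⟩ := exists_excess_shrink_le hp hε (C := C * (1 + M)) (by positivity)
  set K : ℝ := C' + C * M with hK
  have hK0 : 0 ≤ K := by positivity
  set Φ : ℕ → Ω → ℝ := fun k ω => excess ε (Y k ω) ^ p with hΦ
  have hΦ0 : ∀ k ω, 0 ≤ Φ k ω := fun k ω => Real.rpow_nonneg (excess_nonneg _ _) _
  have hΦi : ∀ k, Integrable (Φ k) μ := fun k =>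
    integrable_excess_rpow hp0 hε.le ((hY k).mono (ℱ.le k)).aestronglyMeasurable (hYp k)
  have hΦm : StronglyAdapted ℱ Φ := fun k =>
    (((continuous_excess ε).measurable.comp (hY k).measurable).pow_const p).stronglyMeasurable
  have hstep : ∀ k, μ[Φ (k + 1) | ℱ k] ≤ᵐ[μ] fun ω => (1 - a k) * Φ k ω + K * a k ^ p := by
    intro k
    have h1 := condExp_excess_add_le (y := fun ω => (1 - a k) * Y k ω) hp hC0 hC (ℱ.le k) hε.le
      (ha k).1 ((hY k).const_mul _) (integrable_const_mul_abs_rpow _ (hYp k)) (hwi k) (hw0 k)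
      (hwp k) (hM k)
    have h2 : Φ (k + 1) = fun ω => excess ε ((1 - a k) * Y k ω + a k * w k ω) ^ p := by
      ext ω; simp only [hΦ, hrec]
    rw [h2]
    filter_upwards [h1] with ω h
    have := hC' (a k) (Y k ω) (ha k).1 (ha k).2
    simp only [hΦ]
    rw [hK]
    linarith
  -- The error `K * a k ^ p` is `a k` times `K * a k ^ (p - 1)`, which tends to zero, so the means
  -- follow an averaging recursion with divergent weights.
  have hmean : Tendsto (fun k => ∫ ω, Φ k ω ∂μ) atTop (𝓝 0) := by
    have ha0 : Tendsto a atTop (𝓝 0) := by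
      have := hsump.tendsto_atTop_zero.rpow_const (p := p⁻¹) (Or.inr (by positivity))
      rw [Real.zero_rpow (by positivity)] at this
      refine this.congr fun k => ?_
      rw [← Real.rpow_mul (ha k).1, mul_inv_cancel₀ (by positivity), Real.rpow_one]
    have har : Tendsto (fun k => K * a k ^ (p - 1)) atTop (𝓝 0) := by
      have := (ha0.rpow_const (p := p - 1) (Or.inr (by linarith))).const_mul K
      rwa [Real.zero_rpow (by linarith), mul_zero] at this
    refine tendsto_zero_of_averaging (fun k => integral_nonneg (hΦ0 k))
      (Eventually.of_forall ha) hsum har (Eventually.of_forall fun k => ?_)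
    have e : a k * (K * a k ^ (p - 1)) = K * a k ^ p := by
      have h := Real.rpow_add_of_nonneg (ha k).1 (by linarith : 0 ≤ p - 1) zero_le_one
      rw [sub_add_cancel, Real.rpow_one] at h
      rw [h]; ring
    rw [← integral_condExp (ℱ.le k), e]
    calc ∫ ω, (μ[Φ (k + 1) | ℱ k]) ω ∂μ ≤ ∫ ω, ((1 - a k) * Φ k ω + K * a k ^ p) ∂μ :=
          integral_mono_ae integrable_condExp
            (((hΦi k).const_mul _).add (integrable_const _)) (hstep k)
      _ = (1 - a k) * ∫ ω, Φ k ω ∂μ + K * a k ^ p := by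
          rw [integral_add ((hΦi k).const_mul _) (integrable_const _), integral_const_mul]
          simp
  -- The tail sum compensates the error terms still to come and makes `Φ + T` a supermartingale.
  set T : ℕ → ℝ := fun k => ∑' j, K * a (j + k) ^ p with hT
  have hsumK : Summable fun k => K * a k ^ p := hsump.mul_left K
  have hT0 : ∀ k, 0 ≤ T k := fun k =>
    tsum_nonneg fun j => mul_nonneg hK0 (Real.rpow_nonneg (ha _).1 _)
  have hTs : ∀ k, T k = K * a k ^ p + T (k + 1) := by
    intro k
    have h := ((summable_nat_add_iff k).mpr hsumK).tsum_eq_zero_add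
    rw [hT]
    simp only [h, zero_add]
    congr 2
    ext j
    congr 3
    ring
  have hTlim : Tendsto T atTop (𝓝 0) := tendsto_sum_nat_add fun k => K * a k ^ p
  have hsuper : Supermartingale (fun k ω => Φ k ω + T k) ℱ μ := by
    refine supermartingale_nat (fun k => (hΦm k).add stronglyMeasurable_const)
      (fun k => (hΦi k).add (integrable_const _)) fun k => ?_
    have h1 := condExp_add (hΦi (k + 1)) (integrable_const (T (k + 1))) (ℱ k) (μ := μ)
    filter_upwards [h1, hstep k] with ω e1 e2
    refine e1.trans_le ?_
    rw [Pi.add_apply, condExp_const (ℱ.le k), hTs k]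
    have := mul_nonneg (ha k).1 (hΦ0 k ω)
    linarith
  have hconv : ∀ᵐ ω ∂μ, ∃ l, Tendsto (fun k => -(Φ k ω + T k)) atTop (𝓝 l) := by
    obtain ⟨R, hR⟩ := (hmean.add hTlim).bddAbove_range
    refine hsuper.neg.exists_ae_tendsto_of_bdd (R := R.toNNReal) fun k => ?_
    have hi : Integrable (fun ω => Φ k ω + T k) μ := (hΦi k).add (integrable_const _)
    have hn : eLpNorm (fun ω => -(Φ k ω + T k)) 1 μ = eLpNorm (fun ω => Φ k ω + T k) 1 μ :=
      eLpNorm_neg _ _ _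
    rw [hn, eLpNorm_one_eq_lintegral_enorm, ← ofReal_integral_norm_eq_lintegral_enorm hi]
    refine ENNReal.ofReal_le_ofReal ?_
    have hnorm : ∀ ω, ‖Φ k ω + T k‖ = Φ k ω + T k := fun ω =>
      Real.norm_of_nonneg (add_nonneg (hΦ0 k ω) (hT0 k))
    simp_rw [hnorm]
    rw [integral_add (hΦi k) (integrable_const _)]
    refine le_trans (le_of_eq ?_) (hR ⟨k, rfl⟩)
    simp
  -- Almost sure convergence is known, but not the limit; convergence of the means to zero gives a
  -- subsequence that identifies it.
  have hmeas : TendstoInMeasure μ Φ atTop (fun _ => (0 : ℝ)) := by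
    refine tendstoInMeasure_of_tendsto_eLpNorm one_ne_zero
      (fun k => (hΦi k).aestronglyMeasurable) aestronglyMeasurable_const ?_
    have : ∀ k, eLpNorm (Φ k - fun _ => (0 : ℝ)) 1 μ = ENNReal.ofReal (∫ ω, Φ k ω ∂μ) := by
      intro k
      have h0 : (Φ k - fun _ => (0 : ℝ)) = Φ k := by ext ω; simp
      rw [h0, eLpNorm_one_eq_lintegral_enorm, ← ofReal_integral_norm_eq_lintegral_enorm (hΦi k)]
      congr 2
      ext ω
      exact Real.norm_of_nonneg (hΦ0 k ω)
    simp_rw [this]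
    simpa using ENNReal.tendsto_ofReal hmean
  obtain ⟨ns, hns, hsub⟩ := hmeas.exists_seq_tendsto_ae
  filter_upwards [hconv, hsub] with ω ⟨l, hl⟩ h0
  have h1 : Tendsto (fun k => Φ k ω) atTop (𝓝 (-l)) := by
    have := hl.neg.sub hTlim
    simpa using this
  rwa [tendsto_nhds_unique (h1.comp hns.tendsto_atTop) h0] at h1

/-- Countably many dead zones, of widths `1 / (n + 1)`, suffice. -/
theorem ae_tendsto_average (hp : 1 < p) (hY0 : Y 0 = 0)
    (hrec : ∀ k ω, Y (k + 1) ω = (1 - a k) * Y k ω + a k * w k ω)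
    (hw : ∀ k, StronglyMeasurable[ℱ (k + 1)] (w k))
    (hwi : ∀ k, Integrable (w k) μ) (hw0 : ∀ k, μ[w k | ℱ k] =ᵐ[μ] 0)
    (hwp : ∀ k, Integrable (fun ω => |w k ω| ^ p) μ) (hM0 : 0 ≤ M)
    (hM : ∀ k, μ[fun ω => |w k ω| ^ p | ℱ k] ≤ᵐ[μ] fun _ => M)
    (ha : ∀ k, 0 ≤ a k ∧ a k ≤ 1) (hsum : ¬ Summable a) (hsump : Summable fun k => a k ^ p) :
    ∀ᵐ ω ∂μ, Tendsto (fun k => Y k ω) atTop (𝓝 0) := by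
  have hall : ∀ᵐ ω ∂μ, ∀ n : ℕ,
      Tendsto (fun k => excess (1 / ((n : ℝ) + 1)) (Y k ω) ^ p) atTop (𝓝 0) :=
    ae_all_iff.mpr fun n => ae_tendsto_excess_average hp hY0 hrec hw hwi hw0 hwp hM0 hM ha hsum
      hsump (by positivity)
  filter_upwards [hall] with ω hω
  rw [Metric.tendsto_atTop]
  intro δ hδ
  obtain ⟨n, hn⟩ := exists_nat_one_div_lt (half_pos hδ)
  have hpos : 0 < (δ / 2) ^ p := by positivity
  obtain ⟨N, hN⟩ := eventually_atTop.mp ((hω n).eventually_lt_const hpos)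
  refine ⟨N, fun k hk => ?_⟩
  have h1 : excess (1 / ((n : ℝ) + 1)) (Y k ω) < δ / 2 :=
    lt_of_not_ge fun h => absurd (hN k hk) (not_lt.mpr
      (Real.rpow_le_rpow (by positivity) h (by linarith)))
  have h2 : |Y k ω| - 1 / ((n : ℝ) + 1) ≤ excess (1 / ((n : ℝ) + 1)) (Y k ω) := le_max_left _ _
  rw [Real.dist_eq, sub_zero]
  linarith

end Averages

/-! ### The scale and the pathwise argument. -/

/-- A nondecreasing scale for the sequence `n`: it is raised to the current value of `n` only when
that value exceeds `β` times the scale. -/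
noncomputable def growthScale (β : ℝ) (n : ℕ → ℝ) : ℕ → ℝ
  | 0 => max 1 (n 0)
  | k + 1 => if n (k + 1) ≤ β * growthScale β n k then growthScale β n k else n (k + 1)

theorem one_le_growthScale {β : ℝ} (hβ : 1 ≤ β) (n : ℕ → ℝ) (k : ℕ) :
    1 ≤ growthScale β n k := by
  induction k with
  | zero => exact le_max_left _ _
  | succ k ih =>
    rw [growthScale]
    split_ifs with h
    · exact ih
    · push Not at h
      nlinarith

theorem le_mul_growthScale {β : ℝ} (hβ : 1 ≤ β) (n : ℕ → ℝ) (k : ℕ) :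
    n k ≤ β * growthScale β n k := by
  have h1 := one_le_growthScale hβ n k
  cases k with
  | zero =>
    have : n 0 ≤ growthScale β n 0 := le_max_right _ _
    nlinarith
  | succ k =>
    by_cases h : n (k + 1) ≤ β * growthScale β n k
    · rw [growthScale, if_pos h]; exact h
    · have e : growthScale β n (k + 1) = n (k + 1) := by rw [growthScale, if_neg h]
      rw [e] at h1 ⊢
      nlinarith

section Pathwise

variable {d : ℕ} {c : Seminorm ℝ (Vec d)} {F : Vec d → Vec d} {γ β : ℝ} {u w Y : ℕ → Vec d}
  {a : ℕ → ℝ}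

/-- The noise cancels in `x - G • y` as long as the scale keeps the value `G`; what remains is an
average of the old difference and `f`. -/
theorem average_identity {G A : ℝ} (hG : G ≠ 0) (x y f v : Vec d) :
    x + A • (f - x + v) - G • ((1 - A) • y + A • (G⁻¹ • v)) =
      (1 - A) • (x - G • y) + A • f := by
  have : G • A • G⁻¹ • v = A • v := by
    rw [smul_smul, smul_smul]
    congr 1
    field_simp
  rw [smul_add G, this]
  module

/-- Once the averaged scaled noise is small, the scale cannot grow twice. -/
theorem growthScale_eventually_const (hγ0 : 0 ≤ γ) (hγ1 : γ < 1) (hβ : β = 2 / (1 + γ))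
    (hF : ∀ v, c (F v) ≤ γ * c v)
    (hu : ∀ k, u (k + 1) = u k + a k • (F (u k) - u k + w k))
    (ha : ∀ᶠ k in atTop, 0 ≤ a k ∧ a k ≤ 1)
    (hY : ∀ᶠ k in atTop, Y (k + 1) = (1 - a k) • Y k +
      a k • ((growthScale β (fun k => c (u k)) k)⁻¹ • w k))
    (hY0 : Tendsto (fun k => c (Y k)) atTop (𝓝 0)) :
    ∃ g : ℝ, 1 ≤ g ∧ ∀ᶠ k in atTop, growthScale β (fun k => c (u k)) k = g := by
  have hβ1 : 1 < β := by rw [hβ, lt_div_iff₀ (by linarith)]; linarith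
  -- The threshold `β > 1` is still small enough for `F` to map the ball of radius `β * g` into the
  -- ball of radius `g`.
  have hβγ : γ * β ≤ 1 := by
    rw [hβ, ← mul_div_assoc, div_le_one (by linarith)]; linarith
  set G := growthScale β fun k => c (u k) with hG
  have hG1 : ∀ k, 1 ≤ G k := one_le_growthScale hβ1.le _
  have hGs : ∀ k, G (k + 1) = if c (u (k + 1)) ≤ β * G k then G k else c (u (k + 1)) :=
    fun k => rfl
  -- With this margin a difference of size `g * (1 + η)` plus noise of size `g * η` makes exactly `β
  -- * g`, the level that does not trigger a jump.
  set η := (β - 1) / 2 with hη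
  have hη0 : 0 < η := by rw [hη]; linarith
  obtain ⟨N, hN⟩ := eventually_atTop.mp (ha.and (hY.and (hY0.eventually_le_const hη0)))
  have claim : ∀ t, N ≤ t → c (u t) ≤ G t → ∀ n, G (t + n) = G t ∧
      c (u (t + n) - G t • Y (t + n)) ≤ G t * (1 + η) := by
    intro t ht hut n
    have hg := hG1 t
    set g := G t with hgdef
    have hadd : ∀ k, N ≤ k → ∀ b, c (u k - g • Y k) ≤ b → c (u k) ≤ b + g * η := by
      intro k hk b hb
      calc c (u k) = c ((u k - g • Y k) + g • Y k) := by rw [sub_add_cancel]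
        _ ≤ c (u k - g • Y k) + c (g • Y k) := map_add_le_add _ _ _
        _ ≤ b + g * η := by
          rw [map_smul_eq_mul, Real.norm_of_nonneg (by linarith)]
          gcongr
          exact (hN k hk).2.2
    induction n with
    | zero =>
      refine ⟨rfl, ?_⟩
      rw [add_zero]
      calc c (u t - g • Y t) ≤ c (u t) + c (g • Y t) := map_sub_le_add _ _ _
        _ ≤ g + g * η := by
          rw [map_smul_eq_mul, Real.norm_of_nonneg (by linarith)]
          gcongr
          exact (hN t ht).2.2
        _ = _ := by ring
    | succ n ih =>
      obtain ⟨ih1, ih2⟩ := ih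
      obtain ⟨⟨ha0, ha1⟩, hYk, -⟩ := hN (t + n) (by omega)
      have hun : c (u (t + n)) ≤ β * g := by
        have := hadd (t + n) (by omega) _ ih2
        rw [hη] at this
        linarith
      have hz : c (u (t + (n + 1)) - g • Y (t + (n + 1))) ≤ g * (1 + η) := by
        rw [← add_assoc, hu, hYk, ih1, average_identity (by linarith)]
        calc _ ≤ c ((1 - a (t + n)) • (u (t + n) - g • Y (t + n))) +
              c (a (t + n) • F (u (t + n))) := map_add_le_add _ _ _
          _ ≤ (1 - a (t + n)) * (g * (1 + η)) + a (t + n) * (g * (1 + η)) := by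
            rw [map_smul_eq_mul, map_smul_eq_mul, Real.norm_of_nonneg (by linarith),
              Real.norm_of_nonneg ha0]
            have h1 : 0 ≤ 1 - a (t + n) := by linarith
            have h2 : c (F (u (t + n))) ≤ g * (1 + η) := by
              calc c (F (u (t + n))) ≤ γ * (β * g) := (hF _).trans (by gcongr)
                _ = (γ * β) * g := by ring
                _ ≤ 1 * g := by gcongr
                _ ≤ g * (1 + η) := by nlinarith
            gcongr
          _ = _ := by ring
      refine ⟨?_, hz⟩
      have hun' := hadd (t + (n + 1)) (by omega) _ hz
      rw [← add_assoc] at hun' ⊢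
      rw [hGs, ih1, if_pos]
      rw [hη] at hun'
      linarith
  -- A jump sets the scale equal to the current norm, which is the starting condition of `claim`; so
  -- after the first jump past `N` there is none.
  by_cases hjump : ∀ k, N ≤ k → G (k + 1) = G k
  · refine ⟨G N, hG1 N, eventually_atTop.mpr ⟨N, fun k hk => ?_⟩⟩
    induction k, hk using Nat.le_induction with
    | base => rfl
    | succ k hk ih => rw [hjump k hk, ih]
  · push Not at hjump
    obtain ⟨k, hk, hne⟩ := hjump
    have hle : c (u (k + 1)) ≤ G (k + 1) := by
      rw [hGs] at hne ⊢
      split_ifs at hne ⊢ with h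
      · exact absurd rfl hne
      · exact le_rfl
    refine ⟨G (k + 1), hG1 _, eventually_atTop.mpr ⟨k + 1, fun j hj => ?_⟩⟩
    obtain ⟨n, rfl⟩ := Nat.exists_eq_add_of_le hj
    exact (claim (k + 1) (by omega) hle n).1

/-- If the averages of the scaled noise vanish, a contractive recursion tends to its fixed
point. -/
theorem tendsto_zero_of_average_scaled_noise (hγ0 : 0 ≤ γ) (hγ1 : γ < 1) (hβ : β = 2 / (1 + γ))
    (hF : ∀ v, c (F v) ≤ γ * c v)
    (hu : ∀ k, u (k + 1) = u k + a k • (F (u k) - u k + w k))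
    (ha : ∀ᶠ k in atTop, 0 ≤ a k ∧ a k ≤ 1) (hsum : ¬ Summable a)
    (hY : ∀ᶠ k in atTop, Y (k + 1) = (1 - a k) • Y k +
      a k • ((growthScale β (fun k => c (u k)) k)⁻¹ • w k))
    (hY0 : Tendsto (fun k => c (Y k)) atTop (𝓝 0)) :
    Tendsto (fun k => c (u k)) atTop (𝓝 0) := by
  obtain ⟨g, hg1, hg⟩ := growthScale_eventually_const hγ0 hγ1 hβ hF hu ha hY hY0
  have hγ' : 0 < 1 - γ := by linarith
  have hgY : ∀ k, c (g • Y k) = g * c (Y k) := fun k => by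
    rw [map_smul_eq_mul, Real.norm_of_nonneg (by linarith)]
  have htri : ∀ k, c (u k) ≤ c (u k - g • Y k) + g * c (Y k) := fun k => by
    rw [← hgY]
    calc c (u k) = c ((u k - g • Y k) + g • Y k) := by rw [sub_add_cancel]
      _ ≤ _ := map_add_le_add _ _ _
  have hs : Tendsto (fun k => c (u k - g • Y k)) atTop (𝓝 0) := by
    refine tendsto_zero_of_averaging (b := fun k => a k * (1 - γ))
      (r := fun k => γ * g / (1 - γ) * c (Y k)) (fun k => apply_nonneg c _) ?_ ?_ ?_ ?_
    · filter_upwards [ha] with k hk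
      exact ⟨mul_nonneg hk.1 hγ'.le, mul_le_one₀ hk.2 hγ'.le (by linarith)⟩
    · rwa [summable_mul_right_iff hγ'.ne']
    · simpa using hY0.const_mul (γ * g / (1 - γ))
    · filter_upwards [ha, hY, hg] with k hak hYk hgk
      rw [hu, hYk, hgk, average_identity (by linarith)]
      have h1 : 0 ≤ 1 - a k := by linarith [hak.2]
      calc _ ≤ c ((1 - a k) • (u k - g • Y k)) + c (a k • F (u k)) := map_add_le_add _ _ _
        _ = (1 - a k) * c (u k - g • Y k) + a k * c (F (u k)) := by
          rw [map_smul_eq_mul, map_smul_eq_mul, Real.norm_of_nonneg h1,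
            Real.norm_of_nonneg hak.1]
        _ ≤ (1 - a k) * c (u k - g • Y k) +
            a k * (γ * (c (u k - g • Y k) + g * c (Y k))) := by
          have := hak.1
          gcongr
          exact (hF _).trans (by gcongr; exact htri k)
        _ = _ := by field_simp; ring
  refine squeeze_zero (fun k => apply_nonneg c _) htri ?_
  simpa using hs.add (hY0.const_mul g)

end Pathwise

/-! ### Conditional moments of the rescaled noise. -/

section ConditionalMoments

variable {Ω : Type*} {m m0 : MeasurableSpace Ω} {μ : Measure Ω} [IsProbabilityMeasure μ]

/-- The measures with densities `X` and its conditional expectation agree on `m`, so they integrate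
every `m`-measurable `G` alike. Working in `[0, ∞]` avoids integrability of `‖w‖ ^ p`, which may
fail before rescaling. -/
theorem setLIntegral_mul_condLExp (hm : m ≤ m0) {G X : Ω → ENNReal} (hG : Measurable[m] G)
    (hX : AEMeasurable X μ) {s : Set Ω} (hs : MeasurableSet[m] s) :
    ∫⁻ ω in s, G ω * (μ⁻[X | m]) ω ∂μ = ∫⁻ ω in s, G ω * X ω ∂μ := by
  have hG0 : Measurable G := hG.mono hm le_rfl
  have hc : Measurable (μ⁻[X | m]) := measurable_condLExp' m μ X
  have key : (μ.withDensity (μ⁻[X | m])).trim hm = (μ.withDensity X).trim hm := by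
    refine @Measure.ext _ m _ _ fun t ht => ?_
    rw [trim_measurableSet_eq hm ht, trim_measurableSet_eq hm ht, withDensity_apply _ (hm t ht),
      withDensity_apply _ (hm t ht), setLIntegral_condLExp hm μ X ht]
  have conv : ∀ Z : Ω → ENNReal, AEMeasurable Z μ →
      ∫⁻ ω in s, G ω * Z ω ∂μ = ∫⁻ ω in s, G ω ∂((μ.withDensity Z).trim hm) := by
    intro Z hZ
    rw [setLIntegral_trim hm hG hs, setLIntegral_withDensity_eq_lintegral_mul₀ hZ
      hG0.aemeasurable (hm s hs)]
    simp_rw [Pi.mul_apply, mul_comm]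
  rw [conv _ hc.aemeasurable, conv _ hX, key]

theorem condLExp_mul_left (hm : m ≤ m0) {G X : Ω → ENNReal} (hG : Measurable[m] G)
    (hX : AEMeasurable X μ) :
    μ⁻[fun ω => G ω * X ω | m] =ᵐ[μ] fun ω => G ω * (μ⁻[X | m]) ω :=
  (ae_eq_condLExp hm μ _ (hG.mul (measurable_condLExp m μ X))
    fun _ hs => setLIntegral_mul_condLExp hm hG hX hs).symm

theorem condExp_abs_rpow_le_of_condLExp_le (hm : m ≤ m0) {v : Ω → ℝ} {p M : ℝ}
    (hv : AEMeasurable v μ)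
    (hM0 : 0 ≤ M)
    (hM : μ⁻[fun ω => ENNReal.ofReal (|v ω| ^ p) | m] ≤ᵐ[μ] fun _ => ENNReal.ofReal M) :
    Integrable (fun ω => |v ω| ^ p) μ ∧ μ[fun ω => |v ω| ^ p | m] ≤ᵐ[μ] fun _ => M := by
  have hnn : ∀ ω, 0 ≤ |v ω| ^ p := fun ω => by positivity
  have hint : Integrable (fun ω => |v ω| ^ p) μ := by
    refine ⟨(hv.abs.pow_const p).aestronglyMeasurable, ?_⟩
    rw [hasFiniteIntegral_iff_ofReal (ae_of_all _ hnn), ← lintegral_condLExp hm]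
    calc _ ≤ ∫⁻ _, ENNReal.ofReal M ∂μ := lintegral_mono_ae hM
      _ < ⊤ := by simp
  refine ⟨hint, ?_⟩
  filter_upwards [hM, condLExp_ofReal m hint (ae_of_all _ hnn)] with ω h1 h2
  rw [h2] at h1
  exact (ENNReal.ofReal_le_ofReal_iff hM0).mp h1

/-- Rescaling a coordinate of unbiased noise by a predictable scale that matches its conditional
`p`-th moment. -/
theorem scaled_noise_coordinate {d : ℕ} (hm : m ≤ m0) {w : Ω → Vec d} {G : Ω → ℝ} {p M : ℝ}
    (hp : 0 ≤ p) (hM0 : 0 ≤ M) (hw : Integrable w μ) (hw0 : μ[w | m] =ᵐ[μ] 0)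
    (hG : Measurable[m] G) (hG1 : ∀ ω, 1 ≤ G ω)
    (hM : μ⁻[fun ω => ENNReal.ofReal (‖w ω‖ ^ p) | m] ≤ᵐ[μ]
      fun ω => ENNReal.ofReal (M * G ω ^ p)) (i : Fin d) :
    Integrable (fun ω => (G ω)⁻¹ * w ω i) μ ∧ μ[fun ω => (G ω)⁻¹ * w ω i | m] =ᵐ[μ] 0 ∧
      Integrable (fun ω => |(G ω)⁻¹ * w ω i| ^ p) μ ∧
      μ[fun ω => |(G ω)⁻¹ * w ω i| ^ p | m] ≤ᵐ[μ] fun _ => M := by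
  have hGi : StronglyMeasurable[m] fun ω => (G ω)⁻¹ := hG.inv.stronglyMeasurable
  have hGpos : ∀ ω, 0 < G ω := fun ω => one_pos.trans_le (hG1 ω)
  have hwi : Integrable (fun ω => w ω i) μ :=
    (EuclideanSpace.proj (𝕜 := ℝ) i).integrable_comp hw
  have hvm : AEStronglyMeasurable (fun ω => (G ω)⁻¹ * w ω i) μ :=
    (hGi.mono hm).aestronglyMeasurable.mul hwi.aestronglyMeasurable
  have hvi : Integrable (fun ω => (G ω)⁻¹ * w ω i) μ := by
    refine hwi.norm.mono' hvm (ae_of_all _ fun ω => ?_)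
    rw [norm_mul, norm_inv, Real.norm_of_nonneg (hGpos ω).le]
    exact mul_le_of_le_one_left (norm_nonneg _) (inv_le_one_of_one_le₀ (hG1 ω))
  have hv0 : μ[fun ω => (G ω)⁻¹ * w ω i | m] =ᵐ[μ] 0 := by
    have h1 := condExp_mul_of_stronglyMeasurable_left hGi
      (show Integrable ((fun ω => (G ω)⁻¹) * fun ω => w ω i) μ from hvi) hwi
    have h2 := (EuclideanSpace.proj (𝕜 := ℝ) i).comp_condExp_comm (m := m) hw
    filter_upwards [h1, h2, hw0] with ω e1 e2 e3
    refine e1.trans ?_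
    have e4 : μ[fun ω => w ω i | m] ω = 0 := by
      refine e2.symm.trans ?_
      rw [Function.comp_apply, e3]
      simp
    rw [Pi.mul_apply, e4, mul_zero, Pi.zero_apply]
  refine ⟨hvi, hv0, condExp_abs_rpow_le_of_condLExp_le hm hvm.aemeasurable hM0 ?_⟩
  have hgm : Measurable[m] fun ω => ENNReal.ofReal ((G ω)⁻¹ ^ p) :=
    (hG.inv.pow_const p).ennreal_ofReal
  have hXm : AEMeasurable (fun ω => ENNReal.ofReal (‖w ω‖ ^ p)) μ :=
    (hw.aestronglyMeasurable.norm.aemeasurable.pow_const p).ennreal_ofReal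
  have hle : (fun ω => ENNReal.ofReal (|(G ω)⁻¹ * w ω i| ^ p)) ≤ᵐ[μ]
      fun ω => ENNReal.ofReal ((G ω)⁻¹ ^ p) * ENNReal.ofReal (‖w ω‖ ^ p) := by
    refine ae_of_all _ fun ω => ?_
    have hi := (inv_pos.mpr (hGpos ω)).le
    dsimp only
    rw [← ENNReal.ofReal_mul (by positivity), ← Real.mul_rpow hi (norm_nonneg _), abs_mul,
      abs_of_nonneg hi]
    gcongr
    exact PiLp.norm_apply_le (w ω) i
  filter_upwards [condLExp_mono (mΩ := m) hle, condLExp_mul_left hm hgm hXm, hM] with ω e1 e2 e3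
  refine e1.trans (e2.trans_le ?_)
  refine (mul_le_mul_right e3 _).trans_eq ?_
  rw [← ENNReal.ofReal_mul (by have := (inv_pos.mpr (hGpos ω)).le; positivity)]
  congr 1
  rw [Real.inv_rpow (hGpos ω).le]
  have : 0 < G ω ^ p := Real.rpow_pos_of_pos (hGpos ω) p
  field_simp

end ConditionalMoments

/-! ### Step sizes, and measurability with respect to the history. -/

section StepSize

variable {α K ξ : ℝ}

theorem stepSize_pos (hα : 0 < α) (hK : 0 < K) (k : ℕ) : 0 < stepSize α K ξ k := by
  unfold stepSize
  positivity

theorem summable_stepSize_rpow_iff (hα : 0 < α) (hK : 0 < K) (p : ℝ) :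
    Summable (fun k => stepSize α K ξ k ^ p) ↔ 1 < p * ξ := by
  rw [← Real.summable_one_div_nat_add_rpow K (p * ξ),
    ← summable_mul_left_iff (Real.rpow_pos_of_pos hα p).ne' (f := fun n : ℕ => 1 / |n + K| ^ (p * ξ))]
  refine summable_congr fun k => ?_
  have hk : 0 < (k : ℝ) + K := by positivity
  rw [stepSize, Real.mul_rpow hα.le (by positivity), ← Real.rpow_mul hk.le, abs_of_pos hk,
    one_div, ← Real.rpow_neg hk.le]
  ring_nf

theorem summable_stepSize_iff (hα : 0 < α) (hK : 0 < K) :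
    Summable (stepSize α K ξ) ↔ 1 < ξ := by
  simpa using summable_stepSize_rpow_iff (ξ := ξ) hα hK 1

theorem tendsto_stepSize (hξ : 0 < ξ) :
    Tendsto (stepSize α K ξ) atTop (𝓝 0) := by
  have h : Tendsto (fun k : ℕ => (k : ℝ) + K) atTop atTop :=
    tendsto_atTop_add_const_right _ _ tendsto_natCast_atTop_atTop
  have := ((tendsto_rpow_neg_atTop hξ).comp h).const_mul α
  rwa [mul_zero] at this

end StepSize

section History

variable {d : ℕ} {Ω : Type*} [m0 : MeasurableSpace Ω] {H : Vec d → Vec d} {a : ℕ → ℝ}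
  {x w : ℕ → Ω → Vec d}

theorem IsStochApprox.measurable (hx : IsStochApprox H a x w) (hH : Continuous H)
    (hx0 : Measurable (x 0)) (hw : ∀ k, Measurable (w k)) (k : ℕ) : Measurable (x k) := by
  induction k with
  | zero => exact hx0
  | succ k ih =>
    have h : x (k + 1) = fun ω => x k ω + a k • (H (x k ω) - x k ω + w k ω) := funext (hx k)
    rw [h]
    exact ih.add ((((hH.measurable.comp ih).sub ih).add (hw k)).const_smul (a k))

theorem historySigma_le (hx : ∀ k, Measurable (x k)) (k : ℕ) : historySigma x k ≤ m0 :=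
  iSup₂_le fun j _ => (hx j).comap_le

/-- The filtration generated by the iterates. -/
def historyFiltration (x : ℕ → Ω → Vec d) (hx : ∀ k, Measurable (x k)) : Filtration ℕ m0 where
  seq := historySigma x
  mono' _ _ h := biSup_mono fun _ hj => hj.trans h
  le' := historySigma_le hx

omit m0 in
theorem measurable_historySigma {j k : ℕ} (h : j ≤ k) : Measurable[historySigma x k] (x j) :=
  Measurable.mono (comap_measurable (x j))
    (le_iSup₂_of_le (f := fun j (_ : j ≤ k) => MeasurableSpace.comap (x j) inferInstance)
      j h le_rfl) le_rfl

omit m0 in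
-- As `a k ≠ 0`, the recursion can be solved for the noise; hence the filtration generated by the
-- iterates alone makes the noise adapted with a shift of one.
theorem IsStochApprox.measurable_noise (hx : IsStochApprox H a x w) (hH : Continuous H)
    (ha : ∀ k, 0 < a k) (k : ℕ) : Measurable[historySigma x (k + 1)] (w k) := by
  have h : w k = fun ω => (a k)⁻¹ • (x (k + 1) ω - x k ω) - (H (x k ω) - x k ω) := by
    ext1 ω
    rw [hx k ω, add_sub_cancel_left, inv_smul_smul₀ (ha k).ne', add_sub_cancel_left]
  rw [h]
  have h1 : Measurable[historySigma x (k + 1)] (x (k + 1)) := measurable_historySigma le_rfl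
  have h2 : Measurable[historySigma x (k + 1)] (x k) := measurable_historySigma k.le_succ
  exact ((h1.sub h2).const_smul (a k)⁻¹).sub ((hH.measurable.comp h2).sub h2)

end History

/-! ### Almost sure convergence of the iterates. -/

/-- The exponentially weighted averages of a noise sequence. -/
noncomputable def noiseAverage {E : Type*} [AddCommGroup E] [Module ℝ E] (a : ℕ → ℝ) (v : ℕ → E) :
    ℕ → E
  | 0 => 0
  | k + 1 => (1 - a k) • noiseAverage a v k + a k • v k

theorem noiseAverage_apply {d : ℕ} (a : ℕ → ℝ) (v : ℕ → Vec d) (i : Fin d) (k : ℕ) :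
    noiseAverage a v k i = noiseAverage a (fun k => v k i) k := by
  induction k with
  | zero => rfl
  | succ k ih => simp [noiseAverage, ih]

section Convergence

variable {d : ℕ} {c : Seminorm ℝ (Vec d)} {H : Vec d → Vec d} {p : ℝ} {a : ℕ → ℝ}
  {Ω : Type*} [m0 : MeasurableSpace Ω] {μ : Measure Ω} [IsProbabilityMeasure μ]
  {x w : ℕ → Ω → Vec d} {xstar : Vec d}

omit [IsProbabilityMeasure μ] m0 in
theorem measurable_growthScale {β : ℝ} (k : ℕ) :
    Measurable[historySigma x k] fun ω => growthScale β (fun j => c (x j ω - xstar)) k := by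
  have hc : ∀ {j k : ℕ}, j ≤ k → Measurable[historySigma x k] fun ω => c (x j ω - xstar) :=
    fun h => c.continuous_vec.measurable.comp ((measurable_historySigma h).sub_const xstar)
  induction k with
  | zero => exact measurable_const.max (hc le_rfl)
  | succ k ih =>
    have ih' : Measurable[historySigma x (k + 1)]
        fun ω => growthScale β (fun j => c (x j ω - xstar)) k :=
      ih.mono (biSup_mono fun _ hj => hj.trans k.le_succ) le_rfl
    exact Measurable.ite (measurableSet_le (hc le_rfl) (ih'.const_mul β)) ih' (hc le_rfl)

theorem ae_tendsto_of_isStochApprox (hc : IsNormOn c) (hH : IsContractionFor c H)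
    (hfix : H xstar = xstar) (hp : 1 < p) (ha : ∀ k, 0 < a k) (ha0 : Tendsto a atTop (𝓝 0))
    (hsum : ¬ Summable a) (hsump : Summable fun k => a k ^ p)
    (hx0 : Measurable (x 0)) (hw : ∀ k, Measurable (w k)) (hx : IsStochApprox H a x w)
    (hunb : NoiseUnbiased μ x w) (hmom : NoiseMomentGrowth μ p xstar x w) :
    ∀ᵐ ω ∂μ, Tendsto (fun k => x k ω) atTop (𝓝 xstar) := by
  have hp0 : 0 ≤ p := by linarith
  have hHc := hH.continuous hc
  have hxm := hx.measurable hHc hx0 hw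
  obtain ⟨γ, hγ0, hγ1, hγ⟩ := hH
  obtain ⟨N, hN, hN'⟩ := hc.exists_norm_le
  obtain ⟨A, B, hA, hB, hAB⟩ := hmom
  set β : ℝ := 2 / (1 + γ) with hβ
  have hβ1 : 1 ≤ β := by rw [hβ, le_div_iff₀ (by linarith)]; linarith
  set G : ℕ → Ω → ℝ := fun k ω => growthScale β (fun j => c (x j ω - xstar)) k with hG
  have hG1 : ∀ k ω, 1 ≤ G k ω := fun k ω => one_le_growthScale hβ1 _ k
  have hGm : ∀ k, Measurable[historySigma x k] (G k) := fun k => measurable_growthScale k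
  -- Since `‖x - xstar‖ ≤ N * β * G` and `1 ≤ G`, both terms of the growth bound are absorbed into a
  -- multiple of `G ^ p`.
  set M : ℝ := A + B * (N * β) ^ p with hM
  have hM0 : 0 ≤ M := by positivity
  have hMG : ∀ k, μ⁻[fun ω => ENNReal.ofReal (‖w k ω‖ ^ p) | historySigma x k] ≤ᵐ[μ]
      fun ω => ENNReal.ofReal (M * G k ω ^ p) := by
    intro k
    filter_upwards [hAB k] with ω h
    refine h.trans (ENNReal.ofReal_le_ofReal ?_)
    have hg := hG1 k ω
    have h1 : ‖x k ω - xstar‖ ^ p ≤ (N * β) ^ p * G k ω ^ p := by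
      rw [← Real.mul_rpow (by positivity) (by linarith)]
      refine Real.rpow_le_rpow (norm_nonneg _) ?_ hp0
      rw [mul_assoc]
      exact (hN' _).trans (by gcongr; exact le_mul_growthScale hβ1 (fun j => c (x j ω - xstar)) k)
    have h2 : A ≤ A * G k ω ^ p := le_mul_of_one_le_right hA.le (Real.one_le_rpow hg hp0)
    have h3 : B * ‖x k ω - xstar‖ ^ p ≤ B * ((N * β) ^ p * G k ω ^ p) := by gcongr
    rw [hM]
    linarith
  -- Finitely many steps may exceed one, where averaging makes no sense; setting them to zero
  -- changes neither the summability properties nor the recursion for large `k`.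
  set b : ℕ → ℝ := fun k => if a k ≤ 1 then a k else 0 with hb
  have hab : ∀ᶠ k in atTop, b k = a k := by
    filter_upwards [ha0.eventually_le_const one_pos] with k hk
    simp [hb, hk]
  have hab' : ∀ᶠ k in cofinite, b k = a k := by rwa [Nat.cofinite_eq_atTop]
  have hb01 : ∀ k, 0 ≤ b k ∧ b k ≤ 1 := fun k => by
    simp only [hb]
    split_ifs with h
    · exact ⟨(ha k).le, h⟩
    · simp
  have hbsum : ¬ Summable b := fun h =>
    hsum (h.congr_cofinite hab')
  have hbsump : Summable fun k => b k ^ p :=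
    hsump.congr_cofinite (hab'.mono fun k hk => by simp only [hk])
  have hcoord : ∀ᵐ ω ∂μ, ∀ i : Fin d, Tendsto
      (fun k => noiseAverage b (fun k => (G k ω)⁻¹ * w k ω i) k) atTop (𝓝 0) := by
    refine ae_all_iff.mpr fun i => ?_
    have hs := fun k => scaled_noise_coordinate (historySigma_le hxm k) hp0 hM0 (hunb k).1
      (hunb k).2 (hGm k) (hG1 k) (hMG k) i
    refine ae_tendsto_average (ℱ := historyFiltration x hxm) (M := M) (a := b)
      (w := fun k ω => (G k ω)⁻¹ * w k ω i) hp rfl (fun k ω => rfl) (fun k => ?_)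
      (fun k => (hs k).1) (fun k => (hs k).2.1) (fun k => (hs k).2.2.1) hM0
      (fun k => (hs k).2.2.2) hb01 hbsum hbsump
    have h1 : Measurable[historySigma x (k + 1)] (G k) :=
      (hGm k).mono (biSup_mono fun _ hj => hj.trans k.le_succ) le_rfl
    have h2 : Measurable[historySigma x (k + 1)] fun ω => w k ω i :=
      (EuclideanSpace.proj (𝕜 := ℝ) i).continuous.measurable.comp
        (hx.measurable_noise hHc ha k)
    exact (h1.inv.mul h2).stronglyMeasurable
  filter_upwards [hcoord] with ω hω
  have hY : Tendsto (noiseAverage b fun k => (G k ω)⁻¹ • w k ω) atTop (𝓝 0) := by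
    have h1 : Tendsto (fun k => WithLp.ofLp (noiseAverage b (fun k => (G k ω)⁻¹ • w k ω) k))
        atTop (𝓝 0) := by
      refine tendsto_pi_nhds.mpr fun i => ?_
      refine (hω i).congr fun k => ?_
      rw [noiseAverage_apply]
      rfl
    exact ((PiLp.continuous_toLp 2 fun _ : Fin d => ℝ).tendsto 0).comp h1
  have hcY : Tendsto (fun k => c (noiseAverage b (fun k => (G k ω)⁻¹ • w k ω) k)) atTop
      (𝓝 0) := by
    have := (c.continuous_vec.tendsto 0).comp hY
    rwa [map_zero] at this
  -- The fixed point is translated to the origin.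
  have hu := tendsto_zero_of_average_scaled_noise (c := c) (a := a) (β := β)
    (F := fun v => H (v + xstar) - xstar) (u := fun k => x k ω - xstar) (w := fun k => w k ω)
    (Y := noiseAverage b fun k => (G k ω)⁻¹ • w k ω) hγ0 hγ1 hβ
    (fun v => by simpa [hfix] using hγ (v + xstar) xstar)
    (fun k => by
      rw [hx k ω, sub_add_cancel]
      module)
    ((ha0.eventually_le_const one_pos).mono fun k hk => ⟨(ha k).le, hk⟩) hsum
    (hab.mono fun k hk => by rw [noiseAverage, hk]) hcY
  rw [tendsto_iff_norm_sub_tendsto_zero]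
  refine squeeze_zero (fun _ => norm_nonneg _) (fun k => hN' _) ?_
  simpa using hu.const_mul N

end Convergence

/-! ### Construction of admissible noise with independent shocks. -/

/-- The product space is lifted by `ULift` so that the counterexamples live in whatever universe the
convergence statement quantifies over. -/
theorem exists_independent_sequence.{u} {E : Type} [MeasurableSpace E] (P : ℕ → Measure E)
    [∀ k, IsProbabilityMeasure (P k)] :
    ∃ (Ω : Type u) (_ : MeasurableSpace Ω) (μ : Measure Ω) (X : ℕ → Ω → E),
      IsProbabilityMeasure μ ∧ (∀ k, Measurable (X k)) ∧ (∀ k, μ.map (X k) = P k) ∧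
      ProbabilityTheory.iIndepFun X μ := by
  have hup : Measurable (ULift.up.{u} : (ℕ → E) → ULift.{u} (ℕ → E)) :=
    (MeasurableEquiv.ulift.{0, u} (α := ℕ → E)).symm.measurable
  have hdown : Measurable (ULift.down.{u} : ULift.{u} (ℕ → E) → ℕ → E) :=
    (MeasurableEquiv.ulift.{0, u} (α := ℕ → E)).measurable
  set μ : Measure (ULift.{u} (ℕ → E)) := (Measure.infinitePi P).map ULift.up with hμ
  have hX : ∀ k, Measurable fun ω : ULift.{u} (ℕ → E) => ω.down k :=
    fun k => (measurable_pi_apply k).comp hdown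
  have hprob : IsProbabilityMeasure μ := Measure.isProbabilityMeasure_map hup.aemeasurable
  have hlaw : ∀ k, μ.map (fun ω : ULift.{u} (ℕ → E) => ω.down k) = P k := fun k => by
    rw [hμ, Measure.map_map (hX k) hup]
    exact Measure.infinitePi_map_eval P k
  refine ⟨ULift.{u} (ℕ → E), inferInstance, μ, fun k ω => ω.down k, hprob, hX, hlaw, ?_⟩
  rw [ProbabilityTheory.iIndepFun_iff_map_fun_eq_infinitePi_map hX]
  simp_rw [hlaw]
  rw [hμ, Measure.map_map (measurable_pi_lambda _ hX) hup]
  exact Measure.map_id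

/-- The symmetric law with mass `q / 2` at each of `L` and `-L` and the rest at `0`. -/
noncomputable def threePoint (q L : ℝ) : Measure ℝ :=
  ENNReal.ofReal (1 - q) • Measure.dirac 0 +
    (ENNReal.ofReal (q / 2) • Measure.dirac L + ENNReal.ofReal (q / 2) • Measure.dirac (-L))

section ThreePoint

variable {q L : ℝ}

theorem isProbabilityMeasure_threePoint (h0 : 0 ≤ q) (h1 : q ≤ 1) :
    IsProbabilityMeasure (threePoint q L) := by
  constructor
  simp only [threePoint, Measure.add_apply, Measure.smul_apply, measure_univ, smul_eq_mul,
    mul_one]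
  rw [← ENNReal.ofReal_add (by linarith) (by linarith),
    ← ENNReal.ofReal_add (by linarith) (by linarith)]
  ring_nf
  simp

theorem integrable_threePoint (f : ℝ → ℝ) : Integrable f (threePoint q L) := by
  have h : ∀ (r : ℝ) (z : ℝ), Integrable f (ENNReal.ofReal r • Measure.dirac z) := fun r z =>
    (integrable_dirac (by simp)).smul_measure ENNReal.ofReal_ne_top
  exact (h _ _).add_measure ((h _ _).add_measure (h _ _))

theorem integral_threePoint (h0 : 0 ≤ q) (h1 : q ≤ 1) (f : ℝ → ℝ) :
    ∫ z, f z ∂threePoint q L = (1 - q) * f 0 + (q / 2 * f L + q / 2 * f (-L)) := by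
  have h : ∀ (r : ℝ) (z : ℝ), Integrable f (ENNReal.ofReal r • Measure.dirac z) := fun r z =>
    (integrable_dirac (by simp)).smul_measure ENNReal.ofReal_ne_top
  rw [threePoint, integral_add_measure (h _ _) ((h _ _).add_measure (h _ _)),
    integral_add_measure (h _ _) (h _ _)]
  simp only [integral_smul_measure, integral_dirac, smul_eq_mul]
  rw [ENNReal.toReal_ofReal (by linarith), ENNReal.toReal_ofReal (by linarith)]

theorem threePoint_singleton_ge : ENNReal.ofReal (q / 2) ≤ threePoint q L {L} := by
  simp only [threePoint, Measure.add_apply, Measure.smul_apply, smul_eq_mul]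
  calc ENNReal.ofReal (q / 2) = ENNReal.ofReal (q / 2) * Measure.dirac L {L} := by simp
    _ ≤ _ := le_self_add.trans le_add_self

theorem ae_threePoint_abs_le : ∀ᵐ z ∂threePoint q L, |z| ≤ |L| := by
  have h : ∀ (r : ℝ) (y : ℝ), |y| ≤ |L| →
      ∀ᵐ z ∂(ENNReal.ofReal r • Measure.dirac y), |z| ≤ |L| := fun r y hy =>
    Measure.ae_smul_measure ((ae_dirac_eq y).symm ▸ hy) _
  rw [threePoint, ae_add_measure_iff, ae_add_measure_iff]
  exact ⟨h _ _ (by simp), h _ _ le_rfl, h _ _ (by simp)⟩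

end ThreePoint

/-- The sign pointing away from the hyperplane `v i = 0`. -/
noncomputable def awaySign {d : ℕ} (i : Fin d) (v : Vec d) : ℝ := if 0 ≤ v i then 1 else -1

theorem abs_awaySign {d : ℕ} (i : Fin d) (v : Vec d) : |awaySign i v| = 1 := by
  unfold awaySign
  split_ifs <;> simp

theorem measurable_awaySign {d : ℕ} (i : Fin d) : Measurable (awaySign i) :=
  Measurable.ite (measurableSet_le measurable_const
    (EuclideanSpace.proj (𝕜 := ℝ) i).continuous.measurable) measurable_const measurable_const

/-- The `i`-th coordinate is moved by `t` in the direction of its own sign, so for `t ≥ 0` its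
absolute value grows by `t`, whatever `v` is. -/
theorem le_norm_add_awaySign {d : ℕ} (i : Fin d) (v : Vec d) (t : ℝ) :
    t ≤ ‖v + t • (awaySign i v • EuclideanSpace.single i (1 : ℝ))‖ := by
  refine le_trans ?_ (PiLp.norm_apply_le _ i)
  rw [Real.norm_eq_abs]
  simp only [PiLp.add_apply, PiLp.smul_apply, PiLp.single_apply, if_true, smul_eq_mul,
    mul_one, awaySign]
  split_ifs with h
  · rw [mul_one]
    exact le_trans (by linarith) (le_abs_self _)
  · push Not at h
    exact le_trans (by linarith) (neg_le_abs _)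

section Driven

variable {d : ℕ} (i : Fin d) (H : Vec d → Vec d) (a : ℕ → ℝ) (xstar : Vec d)

/-- The direction of the noise at the point `v`: it moves the next iterate away from `xstar`. -/
noncomputable def driveSign (k : ℕ) (v : Vec d) : ℝ :=
  awaySign i (v + a k • (H v - v) - xstar)

/-- The iterates driven by scalar shocks `ζ` acting away from `xstar`. -/
noncomputable def drivenIterate (x₀ : Vec d) (ζ : ℕ → ℝ) : ℕ → Vec d
  | 0 => x₀
  | k + 1 => drivenIterate x₀ ζ k + a k • (H (drivenIterate x₀ ζ k) - drivenIterate x₀ ζ k +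
      (ζ k * driveSign i H a xstar k (drivenIterate x₀ ζ k)) • EuclideanSpace.single i (1 : ℝ))

variable {H a xstar}

theorem measurable_driveSign (hH : Continuous H) (k : ℕ) :
    Measurable (driveSign i H a xstar k) :=
  (measurable_awaySign i).comp
    ((measurable_id.add ((hH.measurable.sub measurable_id).const_smul (a k))).sub_const xstar)

theorem le_norm_drivenIterate_sub {x₀ : Vec d} {ζ : ℕ → ℝ} {k : ℕ} :
    a k * ζ k ≤ ‖drivenIterate i H a xstar x₀ ζ (k + 1) - xstar‖ := by
  set v := drivenIterate i H a xstar x₀ ζ k with hv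
  refine (le_norm_add_awaySign i (v + a k • (H v - v) - xstar) (a k * ζ k)).trans_eq ?_
  congr 1
  rw [drivenIterate, ← hv, driveSign]
  module

end Driven

section Noise

variable {d : ℕ} {Ω : Type*} {m m0 : MeasurableSpace Ω} {μ : Measure Ω} [IsProbabilityMeasure μ]

/-- A predictable sign times an independent centred shock is unbiased, and its conditional moments
are the moments of the shock. -/
theorem shock_noise_moments (hm : m ≤ m0) {i : Fin d} {ζ σ : Ω → ℝ} {p A : ℝ}
    (hζm : Measurable ζ) (hσ : Measurable[m] σ) (hσ1 : ∀ ω, |σ ω| = 1)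
    (hind : ProbabilityTheory.Indep (MeasurableSpace.comap ζ inferInstance) m μ)
    (hζ : Integrable ζ μ) (hζ0 : ∫ ω, ζ ω ∂μ = 0)
    (hζp : Integrable (fun ω => |ζ ω| ^ p) μ) (hA : ∫ ω, |ζ ω| ^ p ∂μ ≤ A) :
    Integrable (fun ω => (ζ ω * σ ω) • EuclideanSpace.single i (1 : ℝ)) μ ∧
      μ[fun ω => (ζ ω * σ ω) • EuclideanSpace.single i (1 : ℝ) | m] =ᵐ[μ] 0 ∧
      μ⁻[fun ω => ENNReal.ofReal (‖(ζ ω * σ ω) • EuclideanSpace.single i (1 : ℝ)‖ ^ p) | m] ≤ᵐ[μ]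
        fun _ => ENNReal.ofReal A := by
  have hσs : StronglyMeasurable[m] σ := hσ.stronglyMeasurable
  have hint : Integrable (ζ * σ) μ := by
    refine hζ.norm.mono' (hζ.aestronglyMeasurable.mul (hσs.mono hm).aestronglyMeasurable)
      (ae_of_all _ fun ω => ?_)
    rw [Pi.mul_apply, norm_mul, Real.norm_eq_abs (σ ω), hσ1, mul_one]
  have hle : MeasurableSpace.comap ζ inferInstance ≤ m0 := hζm.comap_le
  have hζ' : Measurable[MeasurableSpace.comap ζ inferInstance] ζ := comap_measurable ζ
  refine ⟨hint.smul_const _, ?_, ?_⟩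
  · have h1 := condExp_mul_of_stronglyMeasurable_right hσs hint hζ
    have h2 := condExp_indep_eq hle hm hζ'.stronglyMeasurable hind
    have h3 := (ContinuousLinearMap.toSpanSingleton ℝ
      (EuclideanSpace.single i (1 : ℝ) : Vec d)).comp_condExp_comm (m := m) hint
    filter_upwards [h1, h2, h3] with ω e1 e2 e3
    refine e3.symm.trans ?_
    rw [Function.comp_apply, e1, Pi.mul_apply, e2, hζ0, zero_mul, map_zero, Pi.zero_apply]
  · have hnorm : ∀ ω, ‖(ζ ω * σ ω) • (EuclideanSpace.single i (1 : ℝ) : Vec d)‖ = |ζ ω| :=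
      fun ω => by
        rw [norm_smul, PiLp.norm_single, norm_one, mul_one, norm_mul,
          Real.norm_eq_abs, Real.norm_eq_abs, hσ1, mul_one]
    simp_rw [hnorm]
    have h1 := condLExp_ofReal m hζp (ae_of_all _ fun ω => by positivity)
    have h2 := condExp_indep_eq (f := fun ω => |ζ ω| ^ p) hle hm
      ((measurable_norm.comp hζ').pow_const p).stronglyMeasurable hind
    filter_upwards [h1, h2] with ω e1 e2
    rw [e1, e2]
    exact ENNReal.ofReal_le_ofReal hA

end Noise

/-- Admissible noise with prescribed independent shocks: in step `k`, with probability at least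
`q k / 2`, the next iterate is pushed to distance at least `a k * L k` from `xstar`. -/
theorem exists_driven_process.{u} {d : ℕ} (hd : 0 < d) {H : Vec d → Vec d} (hH : Continuous H)
    {a q L : ℕ → ℝ} {p A : ℝ} (hp : 0 < p) (hq0 : ∀ k, 0 ≤ q k)
    (hq1 : ∀ k, q k ≤ 1) (hL : ∀ k, 0 ≤ L k) (hA0 : 0 < A) (hA : ∀ k, q k * L k ^ p ≤ A)
    (xstar : Vec d) (ν : Measure (Vec d)) [IsProbabilityMeasure ν] :
    ∃ (Ω : Type u) (_ : MeasurableSpace Ω) (μ : Measure Ω) (x w : ℕ → Ω → Vec d)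
      (E : ℕ → Set Ω), IsProbabilityMeasure μ ∧ Measurable (x 0) ∧ μ.map (x 0) = ν ∧
        (∀ k, Measurable (w k)) ∧ IsStochApprox H a x w ∧ NoiseUnbiased μ x w ∧
        NoiseMomentGrowth μ p xstar x w ∧ (∀ k, ∀ᵐ ω ∂μ, ‖w k ω‖ ≤ L k) ∧
        (∀ k, MeasurableSet (E k)) ∧ ProbabilityTheory.iIndepSet E μ ∧
        (∀ k, ENNReal.ofReal (q k / 2) ≤ μ (E k)) ∧
        ∀ k, ∀ ω ∈ E k, a k * L k ≤ ‖x (k + 1) ω - xstar‖ := by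
  have hprob : ∀ k, IsProbabilityMeasure (threePoint (q k) (L k)) := fun k =>
    isProbabilityMeasure_threePoint (hq0 k) (hq1 k)
  -- The first component of `X 0` is the initial point and the second component of `X (k + 1)` is
  -- the shock of step `k`, whence the index `k - 1`. The other components serve only to give all
  -- variables one common space.
  obtain ⟨Ω, _, μ, X, hμ, hX, hlaw, hind⟩ := exists_independent_sequence.{u}
    fun k => ν.prod (threePoint (q (k - 1)) (L (k - 1)))
  set i : Fin d := ⟨0, hd⟩
  set ζ : ℕ → Ω → ℝ := fun k ω => (X (k + 1) ω).2 with hζ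
  set x : ℕ → Ω → Vec d := fun k ω => drivenIterate i H a xstar (X 0 ω).1 (fun j => ζ j ω) k
    with hx
  set σ : ℕ → Ω → ℝ := fun k ω => driveSign i H a xstar k (x k ω) with hσ
  set w : ℕ → Ω → Vec d := fun k ω => (ζ k ω * σ k ω) • EuclideanSpace.single i (1 : ℝ) with hw
  have hζm : ∀ k, Measurable (ζ k) := fun k => (hX (k + 1)).snd
  have hζlaw : ∀ k, μ.map (ζ k) = threePoint (q k) (L k) := fun k => by
    have h : ζ k = Prod.snd ∘ X (k + 1) := rfl
    rw [h, ← Measure.map_map measurable_snd (hX _), hlaw]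
    simp
  set 𝒢 : Filtration ℕ _ := Filtration.natural X fun k => (hX k).stronglyMeasurable with h𝒢
  have hX𝒢 : ∀ {j k : ℕ}, j ≤ k → Measurable[𝒢 k] (X j) := fun {j k} h =>
    Measurable.mono (comap_measurable (X j))
      (le_iSup₂_of_le (f := fun j (_ : j ≤ k) => MeasurableSpace.comap (X j) inferInstance)
        j h le_rfl) le_rfl
  have hx𝒢 : ∀ k, Measurable[𝒢 k] (x k) := by
    intro k
    induction k with
    | zero => exact (hX𝒢 le_rfl).fst
    | succ k ih =>
      have h1 : Measurable[𝒢 (k + 1)] (x k) := ih.mono (𝒢.mono k.le_succ) le_rfl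
      have h2 : Measurable[𝒢 (k + 1)] (ζ k) := (hX𝒢 le_rfl).snd
      have h3 : Measurable[𝒢 (k + 1)] (w k) :=
        (h2.mul ((measurable_driveSign i hH k).comp h1)).smul_const _
      exact h1.add ((((hH.measurable.comp h1).sub h1).add h3).const_smul (a k))
  have hxm : ∀ k, Measurable (x k) := fun k => (hx𝒢 k).mono (𝒢.le k) le_rfl
  -- The history is determined by `X 0, …, X k`, and the shock of step `k` is read off `X (k + 1)`,
  -- so the two are independent.
  have hhist : ∀ k, historySigma x k ≤ 𝒢 k := fun k => iSup₂_le fun j hj =>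
    ((hx𝒢 j).mono (𝒢.mono hj) le_rfl).comap_le
  have hσm : ∀ k, Measurable[historySigma x k] (σ k) := fun k =>
    (measurable_driveSign i hH k).comp (measurable_historySigma le_rfl)
  have hσ1 : ∀ k ω, |σ k ω| = 1 := fun k ω => abs_awaySign _ _
  have hindep : ∀ k, ProbabilityTheory.Indep (MeasurableSpace.comap (ζ k) inferInstance)
      (historySigma x k) μ := by
    intro k
    have h1 := hind.indep_comap_natural_of_lt (fun k => (hX k).stronglyMeasurable)
      (Nat.lt_succ_self k)
    refine ProbabilityTheory.indep_of_indep_of_le_left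
      (ProbabilityTheory.indep_of_indep_of_le_right h1 (hhist k)) ?_
    exact (Measurable.snd (comap_measurable (X (k + 1)))).comap_le
  have hζint : ∀ k (f : ℝ → ℝ), Measurable f → Integrable (fun ω => f (ζ k ω)) μ ∧
      ∫ ω, f (ζ k ω) ∂μ =
        (1 - q k) * f 0 + (q k / 2 * f (L k) + q k / 2 * f (-L k)) := by
    intro k f hf
    rw [← integral_threePoint (hq0 k) (hq1 k), ← hζlaw k,
      integral_map (hζm k).aemeasurable hf.aestronglyMeasurable]
    refine ⟨(integrable_map_measure hf.aestronglyMeasurable (hζm k).aemeasurable).mp ?_, rfl⟩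
    rw [hζlaw]
    exact integrable_threePoint f
  have hmom := fun k => shock_noise_moments (i := i) (p := p) (A := A)
    (historySigma_le hxm k) (hζm k) (hσm k) (hσ1 k) (hindep k) (hζint k id measurable_id).1
    (by
      have := (hζint k id measurable_id).2
      simp only [id] at this
      rw [this]; ring)
    (hζint k (fun z => |z| ^ p) (measurable_norm.pow_const p)).1
    (by
      rw [(hζint k (fun z => |z| ^ p) (measurable_norm.pow_const p)).2, abs_neg, abs_zero,
        Real.zero_rpow hp.ne', abs_of_nonneg (hL k)]
      linarith [hA k])
  set E : ℕ → Set Ω := fun k => ζ k ⁻¹' {L k} with hE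
  have hEm : ∀ k, MeasurableSet (E k) := fun k => hζm k (measurableSet_singleton _)
  refine ⟨Ω, _, μ, x, w, E, hμ, hxm 0, ?_, ?_, fun k ω => rfl, fun k => ⟨(hmom k).1, (hmom k).2.1⟩,
    ⟨A, 0, hA0, le_rfl, fun k => ?_⟩, fun k => ?_, hEm, ?_, fun k => ?_, fun k ω hω => ?_⟩
  · have h : x 0 = Prod.fst ∘ X 0 := rfl
    rw [h, ← Measure.map_map measurable_fst (hX _), hlaw]
    simp
  · exact fun k => ((hζm k).mul ((hσm k).mono (historySigma_le hxm k) le_rfl)).smul_const _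
  · simp only [zero_mul, add_zero]
    exact (hmom k).2.2
  · have h : ∀ᵐ z ∂(μ.map (ζ k)), |z| ≤ |L k| := by
      rw [hζlaw]
      exact ae_threePoint_abs_le
    filter_upwards [ae_of_ae_map (hζm k).aemeasurable h] with ω hω
    rw [hw, norm_smul, PiLp.norm_single, norm_one, mul_one, norm_mul,
      Real.norm_eq_abs, Real.norm_eq_abs, hσ1, mul_one]
    rwa [abs_of_nonneg (hL k)] at hω
  · rw [ProbabilityTheory.iIndepSet_iff_meas_biInter hEm]
    have h := hind.precomp Nat.succ_injective
    intro s
    refine h.meas_biInter fun k _ => ⟨Prod.snd ⁻¹' {L k}, ?_, rfl⟩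
    exact measurable_snd (measurableSet_singleton _)
  · rw [hE, ← Measure.map_apply (hζm k) (measurableSet_singleton _), hζlaw]
    exact threePoint_singleton_ge
  · have hω' : ζ k ω = L k := hω
    rw [← hω']
    exact le_norm_drivenIterate_sub i (x₀ := (X 0 ω).1) (ζ := fun j => ζ j ω) (k := k)

/-! ### Failure of convergence outside the range of exponents. -/

/-- For `0 ≤ b ≤ 1 / 2` one has `1 - b ≥ exp (-2 * b)`, so the product of the factors stays above
`exp (-2 * ∑ b) > 0`. -/
theorem not_tendsto_zero_of_summable {s b : ℕ → ℝ} {n : ℕ} (hs : 0 < s n)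
    (hb : ∀ k, n ≤ k → 0 ≤ b k ∧ b k ≤ 1 / 2) (hsum : Summable b)
    (hrec : ∀ k, n ≤ k → (1 - b k) * s k ≤ s (k + 1)) : ¬ Tendsto s atTop (𝓝 0) := by
  have hexp : ∀ k, n ≤ k → Real.exp (-(2 * b k)) ≤ 1 - b k := by
    intro k hk
    obtain ⟨h0, h1⟩ := hb k hk
    have h2 : 0 < 1 + 2 * b k := by linarith
    rw [Real.exp_neg]
    calc (Real.exp (2 * b k))⁻¹ ≤ (1 + 2 * b k)⁻¹ := by
          gcongr
          linarith [Real.add_one_le_exp (2 * b k)]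
      _ ≤ 1 - b k := by
          rw [inv_le_iff_one_le_mul₀ h2]
          nlinarith
  have hlow : ∀ j, Real.exp (-(2 * ∑ i ∈ Finset.range j, b (n + i))) * s n ≤ s (n + j) := by
    intro j
    induction j with
    | zero => simp
    | succ j ih =>
      have h1 := hb (n + j) (by omega)
      calc _ = Real.exp (-(2 * b (n + j))) *
            (Real.exp (-(2 * ∑ i ∈ Finset.range j, b (n + i))) * s n) := by
            rw [Finset.sum_range_succ, ← mul_assoc, ← Real.exp_add]
            ring_nf
        _ ≤ (1 - b (n + j)) * s (n + j) := by
            have : 0 ≤ 1 - b (n + j) := by linarith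
            gcongr
            exact hexp _ (by omega)
        _ ≤ s (n + (j + 1)) := hrec _ (by omega)
  have hsum' : Summable fun i => b (n + i) := by
    simpa [add_comm] using (summable_nat_add_iff n).mpr hsum
  intro hlim
  have hlim' : Tendsto (fun j => s (n + j)) atTop (𝓝 0) := by
    simpa [add_comm] using (tendsto_add_atTop_iff_nat n).mpr hlim
  have hle : Real.exp (-(2 * ∑' i, b (n + i))) * s n ≤ 0 := by
    refine ge_of_tendsto' hlim' fun j => le_trans ?_ (hlow j)
    gcongr
    exact hsum'.sum_le_tsum _ fun i _ => (hb (n + i) (by omega)).1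
  exact absurd hle (not_le.mpr (by positivity))

section Necessity

variable {d : ℕ} {c : Seminorm ℝ (Vec d)} {H : Vec d → Vec d} {p : ℝ} {xstar : Vec d}

/-- With `∑ α_k ^ p = ∞`, rare large shocks of bounded `p`-th moment occur infinitely often. -/
theorem exists_not_tendsto_of_not_summable_rpow.{u} (hd : 0 < d) (hH : Continuous H)
    {a : ℕ → ℝ} (ha : ∀ k, 0 < a k) (hp : 0 < p) (hsum : ¬ Summable fun k => a k ^ p)
    (ν : Measure (Vec d)) [IsProbabilityMeasure ν] :
    ∃ (Ω : Type u) (_ : MeasurableSpace Ω) (μ : Measure Ω) (x w : ℕ → Ω → Vec d),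
      IsProbabilityMeasure μ ∧ Measurable (x 0) ∧ μ.map (x 0) = ν ∧ (∀ k, Measurable (w k)) ∧
      IsStochApprox H a x w ∧ NoiseUnbiased μ x w ∧ NoiseMomentGrowth μ p xstar x w ∧
      ¬ ∀ᵐ ω ∂μ, Tendsto (fun k => x k ω) atTop (𝓝 xstar) := by
  -- With shocks of size `(a k)⁻¹` this probability keeps the `p`-th moment at most one. Capping at
  -- one does not destroy divergence: if `q` were summable, the cap would be active only finitely
  -- often.
  set q : ℕ → ℝ := fun k => min 1 (a k ^ p) with hq
  have hap : ∀ k, 0 < a k ^ p := fun k => Real.rpow_pos_of_pos (ha k) p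
  have hq0 : ∀ k, 0 ≤ q k := fun k => le_min zero_le_one (hap k).le
  obtain ⟨Ω, _, μ, x, w, E, hμ, hx0, hlaw, hw, hx, hunb, hmom, -, hEm, hEi, hEq, hE⟩ :=
    exists_driven_process.{u} hd hH (L := fun k => (a k)⁻¹) (A := 1) hp hq0
      (fun k => min_le_left _ _) (fun k => (inv_pos.mpr (ha k)).le) one_pos
      (fun k => by
        rw [Real.inv_rpow (ha k).le, ← div_eq_mul_inv, div_le_one (hap k)]
        exact min_le_right _ _) xstar ν
  refine ⟨Ω, _, μ, x, w, hμ, hx0, hlaw, hw, hx, hunb, hmom, fun hconv => ?_⟩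
  have hqsum : ¬ Summable q := by
    intro h
    refine hsum (h.congr_cofinite ?_)
    rw [Nat.cofinite_eq_atTop]
    filter_upwards [h.tendsto_atTop_zero.eventually_lt_const one_pos] with k hk
    rcases min_choice 1 (a k ^ p) with h1 | h1
    · exact absurd (h1.symm.trans_lt hk) (lt_irrefl _)
    · exact h1
  have hEsum : ∑' k, μ (E k) = ⊤ := by
    by_contra hne
    have hne' : ∑' k, ENNReal.ofReal (q k / 2) ≠ ⊤ :=
      ne_top_of_le_ne_top hne (ENNReal.tsum_le_tsum hEq)
    have h1 := ENNReal.summable_toReal hne'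
    refine hqsum ((summable_div_const_iff (two_ne_zero)).mp (h1.congr fun k => ?_))
    exact ENNReal.toReal_ofReal (by linarith [hq0 k])
  have hlimsup : ∀ᵐ ω ∂μ, ω ∈ limsup E atTop :=
    (mem_ae_iff_prob_eq_one (MeasurableSet.measurableSet_limsup hEm)).mpr
      (ProbabilityTheory.measure_limsup_eq_one hEm hEi hEsum)
  obtain ⟨ω, h1, h2⟩ := (hlimsup.and hconv).exists
  rw [mem_limsup_iff_frequently_mem] at h1
  have h3 : Tendsto (fun k => ‖x (k + 1) ω - xstar‖) atTop (𝓝 0) :=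
    (tendsto_iff_norm_sub_tendsto_zero.mp h2).comp (tendsto_add_atTop_nat 1)
  obtain ⟨k, hk1, hk2⟩ := (h1.and_eventually (h3.eventually_lt_const one_pos)).exists
  have h4 := hE k ω hk1
  rw [mul_inv_cancel₀ (ha k).ne'] at h4
  linarith

/-- With `∑ α_k < ∞`, a single shock is never forgotten. -/
theorem exists_not_tendsto_of_summable.{u} (hd : 0 < d) (hc : IsNormOn c)
    (hH : IsContractionFor c H) (hfix : H xstar = xstar) {a : ℕ → ℝ} (ha : ∀ k, 0 < a k)
    (hp : 0 < p) (hsum : Summable a) (ν : Measure (Vec d)) [IsProbabilityMeasure ν] :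
    ∃ (Ω : Type u) (_ : MeasurableSpace Ω) (μ : Measure Ω) (x w : ℕ → Ω → Vec d),
      IsProbabilityMeasure μ ∧ Measurable (x 0) ∧ μ.map (x 0) = ν ∧ (∀ k, Measurable (w k)) ∧
      IsStochApprox H a x w ∧ NoiseUnbiased μ x w ∧ NoiseMomentGrowth μ p xstar x w ∧
      ¬ ∀ᵐ ω ∂μ, Tendsto (fun k => x k ω) atTop (𝓝 xstar) := by
  have hHc := hH.continuous hc
  obtain ⟨γ, hγ0, hγ1, hγ⟩ := hH
  -- One noiseless step reduces `c (x - xstar)` at most by the factor `1 - a k * (1 + γ)`.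
  have hbsum : Summable fun k => a k * (1 + γ) := hsum.mul_right _
  obtain ⟨n, hn⟩ := eventually_atTop.mp
    (hbsum.tendsto_atTop_zero.eventually_le_const (show (0 : ℝ) < 1 / 2 by norm_num))
  obtain ⟨Ω, _, μ, x, w, E, hμ, hx0, hlaw, hw, hx, hunb, hmom, hwL, hEm, hEi, hEq, hE⟩ :=
    -- The only shock is at time `n`, of size one and with a random sign; at other times both atoms
    -- sit at zero. With probability at least `1 / 2` the next iterate differs from `xstar`,
    -- whatever the initial law.
    exists_driven_process.{u} hd hHc (q := fun _ => 1) (L := fun k => if k = n then 1 else 0)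
      (A := 1) hp (fun _ => zero_le_one) (fun _ => le_rfl)
      (fun k => by split_ifs <;> norm_num) one_pos
      (fun k => by
        split_ifs
        · simp
        · simp [Real.zero_rpow hp.ne']) xstar ν
  refine ⟨Ω, _, μ, x, w, hμ, hx0, hlaw, hw, hx, hunb, hmom, fun hconv => ?_⟩
  have hEpos : μ (E n) ≠ 0 :=
    (lt_of_lt_of_le (ENNReal.ofReal_pos.mpr (by norm_num)) (hEq n)).ne'
  have hwall : ∀ᵐ ω ∂μ, ∀ k, ‖w k ω‖ ≤ if k = n then 1 else 0 := ae_all_iff.mpr hwL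
  obtain ⟨ω, hωE, hωw, hω⟩ : ∃ ω ∈ E n, (∀ k, ‖w k ω‖ ≤ if k = n then 1 else 0) ∧
      Tendsto (fun k => x k ω) atTop (𝓝 xstar) := by
    by_contra hcon
    push Not at hcon
    refine hEpos (measure_mono_null (fun ω hω => ?_) (ae_iff.mp (hwall.and hconv)))
    exact fun h => hcon ω hω h.1 h.2
  have hstart : 0 < c (x (n + 1) ω - xstar) := by
    refine lt_of_le_of_ne (apply_nonneg c _) fun h0 => ?_
    have h1 := hE n ω hωE
    rw [if_pos rfl, mul_one, hc _ h0.symm, norm_zero] at h1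
    exact absurd h1 (not_le.mpr (ha n))
  refine not_tendsto_zero_of_summable (s := fun k => c (x k ω - xstar)) hstart
    (fun k hk => ⟨mul_nonneg (ha k).le (by linarith), hn k (by omega)⟩) hbsum
    (fun k hk => ?_) ?_
  · have hwk : w k ω = 0 := by
      have := hωw k
      rw [if_neg (by omega)] at this
      exact norm_le_zero_iff.mp this
    set u := x k ω - xstar with hu
    have hrec : x (k + 1) ω - xstar = u - a k • (x k ω - H (x k ω)) := by
      rw [hx k ω, hwk, hu]
      module
    have h1 : c (x k ω - H (x k ω)) ≤ (1 + γ) * c u := by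
      calc c (x k ω - H (x k ω)) = c (u - (H (x k ω) - H xstar)) := by
            rw [hu, hfix]; congr 1; abel
        _ ≤ c u + c (H (x k ω) - H xstar) := map_sub_le_add _ _ _
        _ ≤ c u + γ * c u := by gcongr; exact hγ _ _
        _ = _ := by ring
    have h2 : c u ≤ c (x (k + 1) ω - xstar) + a k * c (x k ω - H (x k ω)) := by
      calc c u = c ((x (k + 1) ω - xstar) + a k • (x k ω - H (x k ω))) := by
            rw [hrec, sub_add_cancel]
        _ ≤ _ := map_add_le_add _ _ _
        _ = _ := by rw [map_smul_eq_mul, Real.norm_of_nonneg (ha k).le]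
    have h3 := mul_le_mul_of_nonneg_left h1 (ha k).le
    linarith
  · have h1 : Tendsto (fun k => x k ω - xstar) atTop (𝓝 0) := by
      simpa using hω.sub_const xstar
    have := (c.continuous_vec.tendsto 0).comp h1
    rwa [map_zero] at this

end Necessity

/-! ### The equivalence. -/

theorem mainTheorem6 (d : ℕ) (hd : 0 < d)
    (c : Seminorm ℝ (Vec d)) (hc : IsNormOn c)
    (H : Vec d → Vec d) (hH : IsContractionFor c H)
    (p : ℝ) (hp : 1 < p) (α K ξ : ℝ) (hα : 0 < α) (hK : 0 < K)
    (ν : Measure (Vec d)) [IsProbabilityMeasure ν] :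
    ∃ xstar : Vec d, H xstar = xstar ∧ (∀ y : Vec d, H y = y → y = xstar) ∧
      ((∀ (Ω : Type*) [MeasurableSpace Ω] (μ : Measure Ω) [IsProbabilityMeasure μ]
          (x w : ℕ → Ω → Vec d),
          Measurable (x 0) → μ.map (x 0) = ν → (∀ k, Measurable (w k)) →
          IsStochApprox H (stepSize α K ξ) x w →
          NoiseUnbiased μ x w →
          NoiseMomentGrowth μ p xstar x w →
          ∀ᵐ ω ∂μ, Tendsto (fun k => x k ω) atTop (𝓝 xstar))
        ↔ ξ ∈ Set.Ioc (1 / p) 1) := by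
  obtain ⟨xstar, hfix, huniq⟩ := hH.exists_fixedPoint hc
  have hp0 : 0 < p := by linarith
  have ha : ∀ k, 0 < stepSize α K ξ k := stepSize_pos hα hK
  refine ⟨xstar, hfix, huniq, fun hconv => ⟨?_, ?_⟩, fun hξ => ?_⟩
  · by_contra hle
    have hsum : ¬ Summable fun k => stepSize α K ξ k ^ p := by
      rwa [summable_stepSize_rpow_iff hα hK, ← div_lt_iff₀' hp0]
    obtain ⟨Ω, _, μ, x, w, hμ, hx0, hlaw, hw, hx, hunb, hmom, hnot⟩ :=
      exists_not_tendsto_of_not_summable_rpow (xstar := xstar) hd (hH.continuous hc) ha hp0 hsum ν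
    exact hnot (hconv Ω μ x w hx0 hlaw hw hx hunb hmom)
  · by_contra hgt
    have hsum : Summable (stepSize α K ξ) := by
      rwa [summable_stepSize_iff hα hK, ← not_le]
    obtain ⟨Ω, _, μ, x, w, hμ, hx0, hlaw, hw, hx, hunb, hmom, hnot⟩ :=
      exists_not_tendsto_of_summable hd hc hH hfix ha hp0 hsum ν
    exact hnot (hconv Ω μ x w hx0 hlaw hw hx hunb hmom)
  · intro Ω _ μ _ x w hx0 _ hw hx hunb hmom
    have hξ0 : 0 < ξ := (by positivity : 0 < 1 / p).trans hξ.1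
    refine ae_tendsto_of_isStochApprox hc hH hfix hp ha (tendsto_stepSize hξ0) ?_ ?_ hx0 hw hx
      hunb hmom
    · rw [summable_stepSize_iff hα hK]
      exact not_lt.mpr hξ.2
    · rw [summable_stepSize_rpow_iff hα hK, ← div_lt_iff₀' hp0]
      exact hξ.1
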